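/- Let $k$ be an algebraically closed, complete normed field of characteristic zero and let $\mathcal O_n$ be one of the rings $k[x_1,\dots,x_n]_{(x_1,\dots,x_n)}$ (rational functions regular at the origin), $k\{x_1,\dots,x_n\}$ (locally convergent power series), $k[[x_1,\dots,x_n]]$ (formal power series). Let $0\ne f\in\mathcal O_n$ be a non-unit, and let $X=\{f=0\}$ be the corresponding hypersurface germ, possibly reducible or non-reduced, with local ring $\mathcal O_X=\mathcal O_n/(f)$. A finite modification $\nu:X'\to X$ is given by a ring extension $\mathcal O_X\subset\mathcal O_{X'}$ that is finite and birational: for some $s\in\mathcal O_X$ which is a zero divisor neither in $\mathcal O_X$ nor in $\mathcal O_{X'}$, the map $\mathcal O_X[s^{-1}]\to\mathcal O_{X'}[s^{-1}]$ is an isomorphism. (Such a $\nu$ is surjective and is an isomorphism outside the singular locus of $X$.) The relative adjoint ideal is $Adj_{X'/X}=\{g\in\mathcal O_n:\ g\,\mathcal O_{X'}\subset\mathcal O_X\}$. A module over a ring is torsion-free if no non-zero-divisor of the ring kills a non-zero element. An $\mathcal O_X$-module $E$ is called $X'/X$-saturated if the canonical map $E\to\nu_*(\nu^*E/\mathrm{Torsion})$,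 $e\mapsto[1\otimes e]$, is an isomorphism, where $\nu^*E=\mathcal O_{X'}\otimes_{\mathcal O_X}E$. Then: (0) Every torsion-free $\mathcal O_X$-module is $X/X$-saturated. (1) Let $E$ be a torsion-free $\mathcal O_X$-module, and suppose that either $X$ is reduced, or $E$ is finitely generated and no non-zero nilpotent element of $\mathcal O_X$ annihilates $E$ (for instance, $E$ is finitely generated and faithful). Then there is a maximal finite modification $X'\to X$ for which $E$ is $X'/X$-saturated, and it is unique up to isomorphism over $X$. Maximal means: if $X''\to X$ is any finite modification for which $E$ is $X''/X$-saturated, then $X'\to X$ factorizes as $X'\to X''\to X$. Now let $d>1$ and let $M$ be a $d\times d$ matrix with entries in the maximal ideal of $\mathcal O_n$ and with $\det M=f$. Let $E=\ker(M)\subset\mathcal O_X^{\oplus d}$ be its kernel module, let $\mathrm{tr}(E)=\ker(M^{T})\subset\mathcal O_X^{\oplus d}$ be the Auslander transpose of $E$, and let $\mathrm{adj}(M)$ be the adjoint (adjugate) matrix, so that $M\,\mathrm{adj}(M)=\det(M)\mathbf 1$. Let $X'\to X$ be any finite modification. (2) $E$ is $X'/X$-saturated if and only if all entries of $\mathrm{adj}(M)$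 lie in $Adj_{X'/X}$. (3) $E$ is $X'/X$-saturated if and only if $\mathrm{tr}(E)$ is $X'/X$-saturated. -/

import Mathlib

universe u v w

noncomputable section

open scoped TensorProduct nonZeroDivisors

/-! ### The three rings of germs of functions at the origin of `kⁿ` -/

/-- The formal power series `p` converges absolutely on some polydisc of positive radius. -/
def IsConvergent {k : Type u} [NormedField k] {n : ℕ} (p : MvPowerSeries (Fin n) k) : Prop :=
  ∃ r : ℝ, 0 < r ∧ Summable fun m : Fin n →₀ ℕ => ‖MvPowerSeries.coeff m p‖ * r ^ m.degree

section

variable {k : Type u} [NormedField k] {n : ℕ}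

theorem summable_of_radius_le {p : MvPowerSeries (Fin n) k} {r t : ℝ} (ht : 0 < t) (h : t ≤ r)
    (hp : Summable fun m : Fin n →₀ ℕ => ‖MvPowerSeries.coeff m p‖ * r ^ m.degree) :
    Summable fun m : Fin n →₀ ℕ => ‖MvPowerSeries.coeff m p‖ * t ^ m.degree :=
  Summable.of_nonneg_of_le (fun _ => mul_nonneg (norm_nonneg _) (pow_nonneg ht.le _))
    (fun _ => mul_le_mul_of_nonneg_left (pow_le_pow_left₀ ht.le h _) (norm_nonneg _)) hp

theorem isConvergent_C (a : k) :
    IsConvergent (MvPowerSeries.C a : MvPowerSeries (Fin n) k) := by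
  classical
  refine ⟨1, one_pos, summable_of_ne_finset_zero (s := {0}) fun m hm => ?_⟩
  have hm' : m ≠ 0 := by simpa using hm
  simp [MvPowerSeries.coeff_C, hm']

theorem IsConvergent.add {p q : MvPowerSeries (Fin n) k} (hp : IsConvergent p)
    (hq : IsConvergent q) : IsConvergent (p + q) := by
  obtain ⟨r, hr, hp⟩ := hp
  obtain ⟨t, ht, hq⟩ := hq
  have hpos : 0 < min r t := lt_min hr ht
  have hp' := summable_of_radius_le hpos (min_le_left r t) hp
  have hq' := summable_of_radius_le hpos (min_le_right r t) hq
  refine ⟨min r t, hpos, Summable.of_nonneg_of_le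
    (fun _ => mul_nonneg (norm_nonneg _) (pow_nonneg hpos.le _)) (fun m => ?_) (hp'.add hq')⟩
  rw [map_add, ← add_mul]
  exact mul_le_mul_of_nonneg_right (norm_add_le _ _) (pow_nonneg hpos.le _)

theorem IsConvergent.mul {p q : MvPowerSeries (Fin n) k} (hp : IsConvergent p)
    (hq : IsConvergent q) : IsConvergent (p * q) := by
  obtain ⟨r, hr, hp⟩ := hp
  obtain ⟨t, ht, hq⟩ := hq
  have hpos : 0 < min r t := lt_min hr ht
  have hp' := summable_of_radius_le hpos (min_le_left r t) hp
  have hq' := summable_of_radius_le hpos (min_le_right r t) hq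
  have hmul := hp'.mul_of_nonneg hq'
    (fun _ => mul_nonneg (norm_nonneg _) (pow_nonneg hpos.le _))
    (fun _ => mul_nonneg (norm_nonneg _) (pow_nonneg hpos.le _))
  have hpq := summable_sum_mul_antidiagonal_of_summable_mul
    (f := fun m : Fin n →₀ ℕ => ‖MvPowerSeries.coeff m p‖ * (min r t) ^ m.degree)
    (g := fun m : Fin n →₀ ℕ => ‖MvPowerSeries.coeff m q‖ * (min r t) ^ m.degree) hmul
  refine ⟨min r t, hpos, Summable.of_nonneg_of_le
    (fun _ => mul_nonneg (norm_nonneg _) (pow_nonneg hpos.le _)) (fun m => ?_) hpq⟩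
  rw [MvPowerSeries.coeff_mul]
  refine (mul_le_mul_of_nonneg_right (norm_sum_le _ _) (pow_nonneg hpos.le _)).trans
    (le_of_eq ?_)
  rw [Finset.sum_mul]
  refine Finset.sum_congr rfl fun x hx => ?_
  rw [← Finset.HasAntidiagonal.mem_antidiagonal.mp hx, map_add, pow_add, norm_mul]
  ring

end

/-- The ring `k{x₁,…,xₙ}` of locally convergent power series. -/
def convergentPowerSeries (k : Type u) [NormedField k] (n : ℕ) :
    Subalgebra k (MvPowerSeries (Fin n) k) where
  carrier := {p | IsConvergent p}
  algebraMap_mem' a := isConvergent_C a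
  add_mem' hp hq := hp.add hq
  mul_mem' hp hq := hp.mul hq

/-- The maximal ideal of the origin in `k[x₁,…,xₙ]`: the polynomials without constant term. -/
def originIdeal (k : Type u) [Field k] (n : ℕ) : Ideal (MvPolynomial (Fin n) k) :=
  RingHom.ker (MvPolynomial.constantCoeff : MvPolynomial (Fin n) k →+* k)

instance originIdeal_isPrime (k : Type u) [Field k] (n : ℕ) : (originIdeal k n).IsPrime :=
  RingHom.ker_isPrime _

/-- `O` is a ring of germs at the origin of regular functions on `kⁿ`, in one of three senses:
rational functions regular at the origin (the localization of `k[x₁,…,xₙ]` at the ideal of the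
origin), locally convergent power series, or formal power series. -/
def IsFunctionGermRing (k : Type u) [NormedField k] (n : ℕ)
    (O : Type v) [CommRing O] [Algebra k O] : Prop :=
  Nonempty (O ≃ₐ[k] Localization.AtPrime (originIdeal k n)) ∨
  Nonempty (O ≃ₐ[k] convergentPowerSeries k n) ∨
  Nonempty (O ≃ₐ[k] MvPowerSeries (Fin n) k)

/-- The local ring `O/(f)` of the (possibly reducible, possibly non-reduced) hypersurface germ
`{f = 0}`. -/
abbrev HypersurfaceRing {O : Type v} [CommRing O] (f : O) : Type v := O ⧸ Ideal.span {f}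

/-! ### Finite modifications -/

/-- The morphism `ν : Spec B → Spec A` (`A` the ring of the germ `X`, `B` the ring of the
multi-germ `X'`) is a finite modification: it is finite, and birational, that is, an isomorphism
over the complement of the zero locus of some `s`, where both this complement and its preimage
are schematically dense (`s` is not a zero divisor in `A`, nor in `B`).

For such `ν` the ring `B` is a finite extension of `A` inside the total ring of fractions of `A`.
In particular `ν` is surjective, `Spec B` has no embedded components and is as pure dimensional as
`Spec A`, and `ν` is an isomorphism over every normal point of `Spec A`, hence outside of the
singular locus. -/
structure IsFiniteModification (A : Type u) (B : Type v) [CommRing A] [CommRing B]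
    [Algebra A B] : Prop where
  finite : Module.Finite A B
  birational : ∃ s : A, s ∈ A⁰ ∧ algebraMap A B s ∈ B⁰ ∧
    Function.Bijective (Localization.awayMap (algebraMap A B) s)

/-- The relative conductor `Ann_A (B / A)`. -/
def relConductor (A : Type u) (B : Type v) [CommRing A] [CommRing B] [Algebra A B] : Ideal A :=
  Module.annihilator A (B ⧸ LinearMap.range (Algebra.linearMap A B))

/-- The relative adjoint ideal in `O` of a modification `B` of the hypersurface germ `{f = 0}`:
the elements `g` of `O` with `g B ⊆ O/(f)`. -/
def relAdjointIdeal {O : Type v} [CommRing O] (f : O) (B : Type w) [CommRing B]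
    [Algebra (HypersurfaceRing f) B] : Ideal O :=
  (relConductor (HypersurfaceRing f) B).comap (Ideal.Quotient.mk (Ideal.span {f}))

/-! ### Saturated modules -/

/-- The torsion-free pullback `(B ⊗ E) / Torsion` of an `A`-module `E` to `B`; torsion elements
are those killed by a non-zero-divisor of `B`. -/
abbrev TorsionFreePullback (A : Type u) (B : Type v) [CommRing A] [CommRing B] [Algebra A B]
    (E : Type w) [AddCommGroup E] [Module A E] : Type (max v w) :=
  (B ⊗[A] E) ⧸ Submodule.torsion B (B ⊗[A] E)

/-- The canonical `A`-linear map `E → ν_*(ν^*E / Torsion)`, `e ↦ [1 ⊗ e]`. -/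
def toTorsionFreePullback (A : Type u) (B : Type v) [CommRing A] [CommRing B] [Algebra A B]
    (E : Type w) [AddCommGroup E] [Module A E] : E →ₗ[A] TorsionFreePullback A B E :=
  ((Submodule.torsion B (B ⊗[A] E)).mkQ.restrictScalars A) ∘ₗ TensorProduct.mk A B E 1

/-- `E` is saturated with respect to `A → B`: the canonical map `E → ν_*(ν^*E / Torsion)` is an
isomorphism. -/
def IsSaturated (A : Type u) (B : Type v) [CommRing A] [CommRing B] [Algebra A B]
    (E : Type w) [AddCommGroup E] [Module A E] : Prop :=
  Function.Bijective (toTorsionFreePullback A B E)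

/-- `B` is a maximal finite modification of `A` for which `E` is saturated: if `E` is also
saturated for the finite modification `C`, then `Spec B → Spec A` factorizes as
`Spec B → Spec C → Spec A`. -/
structure IsMaximalSaturatingModification (A : Type u) (B : Type u) [CommRing A] [CommRing B]
    [Algebra A B] (E : Type w) [AddCommGroup E] [Module A E] : Prop where
  isFiniteModification : IsFiniteModification A B
  isSaturated : IsSaturated A B E
  factors : ∀ (C : Type u) [CommRing C] [Algebra A C],
    IsFiniteModification A C → IsSaturated A C E → Nonempty (C →ₐ[A] B)

/-! ### Kernels of determinantal representations -/

/-- The kernel module of a square matrix `M` over the hypersurface ring `O/(f)`: the vectors `v`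
over `O/(f)` with `M v = 0`. -/
abbrev kernelModule {O : Type v} [CommRing O] (f : O) {d : ℕ} (M : Matrix (Fin d) (Fin d) O) :
    Submodule (HypersurfaceRing f) (Fin d → HypersurfaceRing f) :=
  LinearMap.ker (M.map (Ideal.Quotient.mk (Ideal.span {f}))).mulVecLin

/-- The matrix `M` is saturated for the modification `B` of `{f = 0}`: every entry of its adjoint
(adjugate) matrix lies in the relative adjoint ideal. -/
def IsSaturatedDetRep {O : Type v} [CommRing O] (f : O) (B : Type w) [CommRing B]
    [Algebra (HypersurfaceRing f) B] {d : ℕ} (M : Matrix (Fin d) (Fin d) O) : Prop :=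
  ∀ i j, M.adjugate i j ∈ relAdjointIdeal f B

end

/-!
Write `A = O/(f)` and let `Q` be the total ring of fractions of `A`.

A finite modification of `A` is the same thing as a finite `A`-subalgebra `C` of `Q`
(`IsFiniteModification.nonempty_algHom_localization`, `IsFiniteModification.of_subalgebra`). For a
torsion-free module `E`, the module `(C ⊗ E) / Torsion` is the image `C·E` of `C ⊗ E` in `Q ⊗ E`,
so `E` is saturated for `C` exactly if `C` lies in the multiplier ring `(E : E) ⊆ Q`
(`IsFiniteModification.isSaturated_iff`).

Hence the only candidate for the maximal saturating modification is the integral closure of `A` in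
`(E : E)`, and the point is its finiteness over `A` (`finite_integralMultiplierRing`). It maps to
`E^m` by its action on generators of `E`, and to the product of the normalizations of the
irreducible components of `X`; an element killed by both maps comes from a nilpotent of `A` that
annihilates `E`, and thus vanishes. For reduced `X` the second map alone is injective. So it
suffices that `O` is Noetherian and that all its quotient domains have finite normalizations
(`HasFiniteNormalizations`).

For the localized polynomial ring this is Noether normalization. For convergent power series
everything follows from the division theorem of Hironaka and Grauert (`exists_division`), applied
with the monomial order that compares the integers `∏ wᵢ ^ mᵢ` for distinct primes `wᵢ`: it shows
that the ring is Noetherian and integrally closed, and it contains Weierstrass division as the case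
of a small weight for one variable. After a linear change of coordinates a proper quotient domain is
therefore finite over a quotient domain of a ring in one variable less, and in characteristic zero
finiteness of normalizations ascends along finite extensions (`finite_integralClosure_of_finite`).
Formal power series are the convergent ones for the trivial norm on `k`.

For the kernel `E` of a matrix `M` with `det M = f`, the factorization `M · adj M = f` gives
`E = im (adj M)`. So `C·E ⊆ E` means that `C` multiplies the entries of `adj M` into `A`, that is,
that they lie in the relative adjoint ideal (`isSaturated_kernelModule_iff`); this condition is
symmetric under transposition.
-/

open scoped TensorProduct nonZeroDivisors ENNReal

/-! ### Finite modifications inside the total ring of fractions -/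

namespace IsFiniteModification

variable {A : Type*} {C : Type*} [CommRing A] [CommRing C] [Algebra A C]

theorem algebraMap_injective (h : IsFiniteModification A C) :
    Function.Injective (algebraMap A C) := by
  obtain ⟨s, hs, -, hb, -⟩ := h.birational
  rw [injective_iff_map_eq_zero]
  intro a ha
  have h1 : Localization.awayMap (algebraMap A C) s (algebraMap A (Localization.Away s) a) = 0 := by
    simp [Localization.awayMap, IsLocalization.Away.map, IsLocalization.map_eq, ha]
  have h2 : algebraMap A (Localization.Away s) a = 0 := hb (by rw [h1, map_zero])
  have hinj : Function.Injective (algebraMap A (Localization.Away s)) :=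
    IsLocalization.injective _ (Submonoid.powers_le.2 hs)
  exact hinj (by rw [h2, map_zero])

/-- Every element of `C` is a fraction over `A`, with denominator regular in `A` and in `C`. -/
theorem exists_mul_eq_algebraMap (h : IsFiniteModification A C) (c : C) :
    ∃ a ∈ A⁰, ∃ a', algebraMap A C a ∈ C⁰ ∧ algebraMap A C a * c = algebraMap A C a' := by
  obtain ⟨s, hs, hsC, hb⟩ := h.birational
  obtain ⟨x, hx⟩ := hb.2 (algebraMap C (Localization.Away (algebraMap A C s)) c)
  obtain ⟨a', ⟨_, k, rfl⟩, rfl⟩ := IsLocalization.exists_mk'_eq (Submonoid.powers s) x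
  refine ⟨s ^ k, pow_mem hs k, a', by rw [map_pow]; exact pow_mem hsC k, ?_⟩
  have hinj : Function.Injective (algebraMap C (Localization.Away (algebraMap A C s))) :=
    IsLocalization.injective _ (Submonoid.powers_le.2 hsC)
  apply hinj
  rw [map_mul, ← hx, Localization.awayMap, IsLocalization.Away.map, IsLocalization.map_mk',
    IsLocalization.mul_mk'_eq_mk'_of_mul, IsLocalization.mk'_eq_iff_eq_mul]
  rw [← map_mul, ← map_mul, mul_comm]
  exact congrArg _ (map_mul (algebraMap A C) a' (s ^ k))

theorem algebraMap_mem_nonZeroDivisors (h : IsFiniteModification A C) {a : A} (ha : a ∈ A⁰) :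
    algebraMap A C a ∈ C⁰ := by
  rw [mem_nonZeroDivisors_iff_right]
  intro c hc
  obtain ⟨b, -, b', hbC, hbb⟩ := h.exists_mul_eq_algebraMap c
  have h1 : b' * a = 0 := h.algebraMap_injective (by
    rw [map_mul, ← hbb, mul_assoc, hc, mul_zero, map_zero])
  rw [(mem_nonZeroDivisors_iff_right.1 ha) b' h1, map_zero] at hbb
  exact (mem_nonZeroDivisors_iff_right.1 hbC) c (by rwa [mul_comm])

/-- The ring of a finite modification of `A` lies in the total ring of fractions of `A`. -/
theorem nonempty_algHom_localization (h : IsFiniteModification A C) :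
    Nonempty (C →ₐ[A] Localization A⁰) := by
  obtain ⟨s, hs, hsC, hb⟩ := h.birational
  let e := RingEquiv.ofBijective (Localization.awayMap (algebraMap A C) s) hb
  have hu : IsUnit (algebraMap A (Localization A⁰) s) :=
    IsLocalization.map_units (Localization A⁰) (⟨s, hs⟩ : A⁰)
  let g : Localization.Away s →+* Localization A⁰ := IsLocalization.Away.lift s hu
  refine ⟨⟨(g.comp e.symm.toRingHom).comp
    (algebraMap C (Localization.Away (algebraMap A C s))), fun a => ?_⟩⟩
  have h1 : e (algebraMap A (Localization.Away s) a) =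
      algebraMap C (Localization.Away (algebraMap A C s)) (algebraMap A C a) := by
    simp [e, Localization.awayMap, IsLocalization.Away.map, IsLocalization.map_eq]
  change g (e.symm (algebraMap C (Localization.Away (algebraMap A C s)) (algebraMap A C a))) = _
  rw [← h1, e.symm_apply_apply]
  exact IsLocalization.Away.lift_eq s hu a

/-- Homomorphisms between finite modifications over the base are unique. -/
theorem algHom_ext {D : Type*} [CommRing D] [Algebra A D] (h : IsFiniteModification A C)
    (hD : IsFiniteModification A D) (φ ψ : C →ₐ[A] D) : φ = ψ := by
  ext c
  obtain ⟨a, ha, a', -, haa⟩ := h.exists_mul_eq_algebraMap c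
  have h1 := congrArg φ haa
  have h2 := congrArg ψ haa
  rw [map_mul, AlgHom.commutes, AlgHom.commutes] at h1 h2
  exact (mem_nonZeroDivisors_iff_left.1 (hD.algebraMap_mem_nonZeroDivisors ha)
    (φ c - ψ c) (by rw [mul_sub, h1, h2, sub_self])) |> sub_eq_zero.1

/-- A finite `A`-subalgebra of the total ring of fractions of `A` is a finite modification: a
common denominator of its generators can serve as the element `s`. -/
theorem of_subalgebra (B : Subalgebra A (Localization A⁰)) [Module.Finite A B] :
    IsFiniteModification A B := by
  classical
  have hinjQ : Function.Injective (algebraMap A (Localization A⁰)) :=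
    IsLocalization.injective _ le_rfl
  have hinj : Function.Injective (algebraMap A B) := fun a b hab =>
    hinjQ (congrArg Subtype.val hab)
  obtain ⟨S, hS⟩ := (Module.Finite.fg_top : (⊤ : Submodule A B).FG)
  obtain ⟨⟨s, hs⟩, hsS⟩ := IsLocalization.exist_integer_multiples_of_finset A⁰
    (S.image ((↑) : B → Localization A⁰))
  have hden (b : B) : ∃ a, algebraMap A B a = algebraMap A B s * b := by
    have hb : b ∈ Submodule.span A (S : Set B) := hS ▸ Submodule.mem_top
    induction hb using Submodule.span_induction with
    | mem x hx =>
      obtain ⟨a, ha⟩ := hsS x (Finset.mem_image_of_mem _ hx)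
      exact ⟨a, Subtype.ext (by simpa [Algebra.smul_def] using ha)⟩
    | zero => exact ⟨0, by simp⟩
    | add x y _ _ hx hy =>
      obtain ⟨a, ha⟩ := hx
      obtain ⟨b, hb⟩ := hy
      exact ⟨a + b, by rw [map_add, ha, hb, mul_add]⟩
    | smul r x _ hx =>
      obtain ⟨a, ha⟩ := hx
      exact ⟨r * a, by rw [map_mul, ha, Algebra.smul_def]; ring⟩
  have hsB : algebraMap A B s ∈ B⁰ := by
    rw [mem_nonZeroDivisors_iff_right]
    intro b hb
    have hu : IsUnit (algebraMap A (Localization A⁰) s) :=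
      IsLocalization.map_units (Localization A⁰) (⟨s, hs⟩ : A⁰)
    have h0 : (b : Localization A⁰) * algebraMap A (Localization A⁰) s = 0 :=
      congrArg Subtype.val hb
    exact Subtype.ext ((hu.mul_left_eq_zero).1 h0)
  refine ⟨inferInstance, s, hs, hsB, ?_, fun y => ?_⟩
  · rw [injective_iff_map_eq_zero]
    intro x hx
    obtain ⟨a, ⟨_, k, rfl⟩, rfl⟩ := IsLocalization.exists_mk'_eq (Submonoid.powers s) x
    rw [Localization.awayMap, IsLocalization.Away.map, IsLocalization.map_mk',
      IsLocalization.mk'_eq_zero_iff] at hx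
    obtain ⟨⟨_, l, rfl⟩, hm⟩ := hx
    have h1 : s ^ l * a = 0 := hinj (by simpa using hm)
    have h2 : a = 0 := mem_nonZeroDivisors_iff_left.1 (pow_mem hs l) a h1
    rw [h2, IsLocalization.mk'_zero]
  · obtain ⟨b, ⟨_, k, rfl⟩, rfl⟩ :=
      IsLocalization.exists_mk'_eq (Submonoid.powers (algebraMap A B s)) y
    obtain ⟨a, ha⟩ := hden b
    refine ⟨IsLocalization.mk' _ a (⟨s ^ (k + 1), k + 1, rfl⟩ : Submonoid.powers s), ?_⟩
    rw [Localization.awayMap, IsLocalization.Away.map, IsLocalization.map_mk',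
      IsLocalization.mk'_eq_iff_eq]
    congr 1
    simp only [ha, map_pow]
    ring

end IsFiniteModification

/-! ### Saturation in terms of multipliers -/

section Saturation

variable {A : Type*} {C : Type*} {E : Type*} [CommRing A] [CommRing C] [Algebra A C]
  [AddCommGroup E] [Module A E]

theorem one_tmul_injective [Module.IsTorsionFree A E] :
    Function.Injective fun e : E => (1 : Localization A⁰) ⊗ₜ[A] e := by
  have h : Function.Injective (TensorProduct.mk A (Localization A⁰) E 1) :=
    (IsLocalizedModule.injective_iff_isRegular A⁰ _).2 fun c =>
      Module.IsTorsionFree.isSMulRegular (isRegular_iff_mem_nonZeroDivisors.2 c.2)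
  exact h

/-- `(C ⊗ E) / Torsion` is the image `C·E` of `C ⊗ E` in `Q ⊗ E`, where `Q` is the total ring of
fractions of `A`. -/
theorem IsFiniteModification.mem_torsion_iff (h : IsFiniteModification A C)
    [Module.IsTorsionFree A E] (ι : C →ₐ[A] Localization A⁰) (x : C ⊗[A] E) :
    x ∈ Submodule.torsion C (C ⊗[A] E) ↔ ι.toLinearMap.rTensor E x = 0 := by
  -- a common denominator brings every tensor into the form `1 ⊗ e`
  have key : ∀ x : C ⊗[A] E, ∃ a ∈ A⁰, ∃ e : E, a • x = (1 : C) ⊗ₜ[A] e := by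
    intro x
    induction x using TensorProduct.induction_on with
    | zero => exact ⟨1, one_mem _, 0, by simp⟩
    | tmul c e =>
      obtain ⟨a, ha, a', -, haa⟩ := h.exists_mul_eq_algebraMap c
      refine ⟨a, ha, a' • e, ?_⟩
      rw [TensorProduct.smul_tmul', Algebra.smul_def, haa, Algebra.algebraMap_eq_smul_one,
        TensorProduct.smul_tmul]
    | add x y hx hy =>
      obtain ⟨a, ha, e, hae⟩ := hx
      obtain ⟨b, hb, e', hbe⟩ := hy
      refine ⟨a * b, mul_mem ha hb, b • e + a • e', ?_⟩
      rw [smul_add, mul_comm a b, mul_smul, hae, mul_comm b a, mul_smul, hbe,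
        TensorProduct.tmul_add, TensorProduct.tmul_smul, TensorProduct.tmul_smul]
  have hunit {a : A} (ha : a ∈ A⁰) (y : Localization A⁰ ⊗[A] E) (hy : a • y = 0) : y = 0 := by
    have hu : IsUnit (algebraMap A (Localization A⁰) a) :=
      IsLocalization.map_units (Localization A⁰) (⟨a, ha⟩ : A⁰)
    rw [← algebraMap_smul (Localization A⁰)] at hy
    exact (hu.smul_eq_zero).1 hy
  constructor
  · intro hx
    obtain ⟨⟨c, hc⟩, hcx⟩ := (Submodule.mem_torsion_iff x).1 hx
    replace hcx : c • x = 0 := hcx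
    -- a multiple of the non-zero-divisor `c` is a non-zero-divisor of `A`
    obtain ⟨a, ha, a', haC, haa⟩ := h.exists_mul_eq_algebraMap c
    have ha' : a' ∈ A⁰ := by
      rw [mem_nonZeroDivisors_iff_right]
      intro b hb
      apply h.algebraMap_injective
      rw [map_zero]
      refine (mem_nonZeroDivisors_iff_right.1 (mul_mem haC hc)) _ ?_
      rw [haa, ← map_mul, hb, map_zero]
    apply hunit ha'
    rw [← map_smul, ← algebraMap_smul C a' x, ← haa, mul_smul, hcx, smul_zero, map_zero]
  · intro hx
    obtain ⟨a, ha, e, hae⟩ := key x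
    have h1 := congrArg (ι.toLinearMap.rTensor E) hae
    rw [map_smul, hx, smul_zero, LinearMap.rTensor_tmul] at h1
    have h2 : e = 0 := one_tmul_injective (A := A) (by simpa using h1.symm)
    rw [h2, TensorProduct.tmul_zero] at hae
    refine (Submodule.mem_torsion_iff x).2
      ⟨⟨algebraMap A C a, h.algebraMap_mem_nonZeroDivisors ha⟩, ?_⟩
    change algebraMap A C a • x = 0
    rw [algebraMap_smul, hae]

/-- A torsion-free module `E` is saturated for `A → C` if and only if multiplication by elements
of `C` inside `Q ⊗ E` preserves `E`. -/
theorem IsFiniteModification.isSaturated_iff (h : IsFiniteModification A C)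
    [Module.IsTorsionFree A E] (ι : C →ₐ[A] Localization A⁰) :
    IsSaturated A C E ↔ ∀ (c : C) (e : E), ∃ e' : E, ι c ⊗ₜ[A] e = 1 ⊗ₜ[A] e' := by
  have hmk (x : C ⊗[A] E) (e : E) : toTorsionFreePullback A C E e =
      (Submodule.torsion C (C ⊗[A] E)).mkQ x ↔ 1 ⊗ₜ[A] e = ι.toLinearMap.rTensor E x := by
    change (Submodule.torsion C (C ⊗[A] E)).mkQ (1 ⊗ₜ[A] e) = _ ↔ _
    rw [Submodule.mkQ_apply, Submodule.mkQ_apply, Submodule.Quotient.eq, h.mem_torsion_iff ι,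
      map_sub, sub_eq_zero, LinearMap.rTensor_tmul]
    simp
  constructor
  · intro hs c e
    obtain ⟨e', he'⟩ := hs.2 ((Submodule.torsion C (C ⊗[A] E)).mkQ (c ⊗ₜ e))
    exact ⟨e', by simpa using ((hmk _ _).1 he').symm⟩
  · intro hs
    refine ⟨?_, fun y => ?_⟩
    · rw [injective_iff_map_eq_zero]
      intro e he
      have := (hmk 0 e).1 (by rw [he, map_zero])
      rw [map_zero] at this
      exact one_tmul_injective (A := A) (by simpa using this)
    · obtain ⟨x, rfl⟩ := Submodule.mkQ_surjective _ y
      induction x using TensorProduct.induction_on with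
      | zero => exact ⟨0, by simp⟩
      | tmul c e =>
        obtain ⟨e', he'⟩ := hs c e
        exact ⟨e', (hmk _ _).2 (by simpa using he'.symm)⟩
      | add x y hx hy =>
        obtain ⟨e, he⟩ := hx
        obtain ⟨e', he'⟩ := hy
        exact ⟨e + e', by rw [map_add, map_add, he, he']⟩

/-- Every torsion-free module is saturated for the identity. -/
theorem isSaturated_self [Module.IsTorsionFree A E] : IsSaturated A A E := by
  have htors : Submodule.torsion A (A ⊗[A] E) = ⊥ := by
    refine eq_bot_iff.2 fun x hx => ?_
    obtain ⟨⟨a, ha⟩, hax⟩ := (Submodule.mem_torsion_iff x).1 hx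
    replace hax : a • x = 0 := hax
    have h1 : a • TensorProduct.lid A E x = a • 0 := by rw [← map_smul, hax, map_zero, smul_zero]
    have h2 := Module.IsTorsionFree.isSMulRegular (M := E)
      (isRegular_iff_mem_nonZeroDivisors.2 ha) h1
    exact (TensorProduct.lid A E).map_eq_zero_iff.1 h2
  have hmk : Function.Bijective (TensorProduct.mk A A E 1) := (TensorProduct.lid A E).symm.bijective
  exact Function.Bijective.comp (g := (Submodule.torsion A (A ⊗[A] E)).mkQ)
    ⟨LinearMap.ker_eq_bot.1 (by rw [Submodule.ker_mkQ, htors]), Submodule.mkQ_surjective _⟩ hmk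

/-- For a submodule `E` of `A^d`, saturation means that `C·E ⊆ E` inside `C^d`. -/
theorem IsFiniteModification.isSaturated_submodule_iff {ι : Type*} (h : IsFiniteModification A C)
    (E : Submodule A (ι → A)) :
    IsSaturated A C E ↔ ∀ (c : C), ∀ e ∈ E, ∃ e' ∈ E, ∀ i,
      c * algebraMap A C (e i) = algebraMap A C (e' i) := by
  have hE : Module.IsTorsionFree A E :=
    ⟨fun r hr x y hxy => Subtype.ext <| funext fun i =>
      hr.1 (congrFun (congrArg Subtype.val hxy) i)⟩
  obtain ⟨j⟩ := h.nonempty_algHom_localization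
  rw [h.isSaturated_iff j]
  -- clearing the denominator of `c` turns both conditions into one over `A`
  have key (c : C) (e e' : E) : j c ⊗ₜ[A] e = 1 ⊗ₜ[A] e' ↔
      ∀ i, c * algebraMap A C (e.1 i) = algebraMap A C (e'.1 i) := by
    obtain ⟨a, ha, a', -, haa⟩ := h.exists_mul_eq_algebraMap c
    have hu : IsUnit (algebraMap A (Localization A⁰) a) :=
      IsLocalization.map_units (Localization A⁰) (⟨a, ha⟩ : A⁰)
    have h1 : algebraMap A (Localization A⁰) a • (j c ⊗ₜ[A] e) =
        (1 : Localization A⁰) ⊗ₜ[A] (a' • e) := by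
      rw [TensorProduct.smul_tmul', smul_eq_mul, ← j.commutes, ← map_mul, haa, j.commutes,
        Algebra.algebraMap_eq_smul_one, TensorProduct.smul_tmul]
    have h2 : algebraMap A (Localization A⁰) a • ((1 : Localization A⁰) ⊗ₜ[A] e') =
        (1 : Localization A⁰) ⊗ₜ[A] (a • e') := by
      rw [algebraMap_smul, TensorProduct.tmul_smul]
    rw [← hu.smul_left_cancel, h1, h2, one_tmul_injective.eq_iff, Subtype.ext_iff, funext_iff]
    refine forall_congr' fun i => ?_
    have hreg := h.algebraMap_mem_nonZeroDivisors ha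
    rw [← mul_cancel_left_mem_nonZeroDivisors hreg, ← mul_assoc, haa, ← map_mul, ← map_mul,
      h.algebraMap_injective.eq_iff]
    rfl
  constructor
  · intro H c e he
    obtain ⟨e', he'⟩ := H c ⟨e, he⟩
    exact ⟨e', e'.2, (key c ⟨e, he⟩ e').1 he'⟩
  · intro H c e
    obtain ⟨e', he', hi⟩ := H c e e.2
    exact ⟨⟨e', he'⟩, (key c e ⟨e', he'⟩).2 hi⟩

end Saturation

/-! ### The maximal saturating modification -/

/-- Every quotient domain `D` of the ring `R` has a finite normalization. The quotient domains and
their fields of fractions are taken in a fixed universe. -/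
def HasFiniteNormalizations (R : Type*) [CommRing R] : Prop :=
  ∀ (D K : Type w) [CommRing D] [IsDomain D] [Field K] [Algebra D K] [IsFractionRing D K]
    (π : R →+* D), Function.Surjective π → Module.Finite D (integralClosure D K)

theorem HasFiniteNormalizations.of_surjective {R S : Type*} [CommRing R] [CommRing S]
    (h : HasFiniteNormalizations.{w} R) (φ : R →+* S) (hφ : Function.Surjective φ) :
    HasFiniteNormalizations.{w} S := fun D K _ _ _ _ _ π hπ =>
  h D K (π.comp φ) (hπ.comp hφ)

section Multipliers

variable {A : Type v} [CommRing A] (E : Type w) [AddCommGroup E] [Module A E]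

/-- The multiplier ring `(E : E)` of `E`: the elements `q` of the total ring of fractions `Q` of
`A` with `q E ⊆ E` inside `Q ⊗ E`. -/
def multiplierRing : Subalgebra A (Localization A⁰) where
  carrier := {q | ∀ e : E, ∃ e' : E, q ⊗ₜ[A] e = (1 : Localization A⁰) ⊗ₜ[A] e'}
  mul_mem' {p q} hp hq e := by
    obtain ⟨e', he'⟩ := hq e
    obtain ⟨e'', he''⟩ := hp e'
    refine ⟨e'', ?_⟩
    rw [← smul_eq_mul, ← TensorProduct.smul_tmul', he', TensorProduct.smul_tmul', smul_eq_mul,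
      mul_one, he'']
  add_mem' {p q} hp hq e := by
    obtain ⟨e', he'⟩ := hq e
    obtain ⟨e'', he''⟩ := hp e
    exact ⟨e'' + e', by rw [TensorProduct.add_tmul, he', he'', TensorProduct.tmul_add]⟩
  algebraMap_mem' a e :=
    ⟨a • e, by rw [Algebra.algebraMap_eq_smul_one, TensorProduct.smul_tmul]⟩

/-- The integral closure of `A` in the multiplier ring of `E`. -/
def integralMultiplierRing : Subalgebra A (Localization A⁰) :=
  multiplierRing E ⊓ integralClosure A (Localization A⁰)

instance isPrime_of_mem_minimalPrimes (P : minimalPrimes A) : P.1.IsPrime := P.2.1.1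

/-- For a minimal prime `P` of `A` the total ring of fractions of `A` maps to the field of
fractions of `A / P`. -/
noncomputable def toResidueFraction (P : minimalPrimes A) :
    Localization A⁰ →+* FractionRing (A ⧸ P.1) :=
  IsLocalization.lift (M := A⁰) (g := algebraMap A (FractionRing (A ⧸ P.1))) fun s => by
    rw [isUnit_iff_ne_zero, IsScalarTower.algebraMap_apply A (A ⧸ P.1), Ne,
      FaithfulSMul.algebraMap_eq_zero_iff, Ideal.Quotient.algebraMap_eq,
      Ideal.Quotient.eq_zero_iff_mem]
    exact Set.disjoint_left.1 (Ideal.disjoint_nonZeroDivisors_of_mem_minimalPrimes P.2).symm s.2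

theorem toResidueFraction_algebraMap (P : minimalPrimes A) (a : A) :
    toResidueFraction P (algebraMap A (Localization A⁰) a) =
      algebraMap (A ⧸ P.1) (FractionRing (A ⧸ P.1)) (Ideal.Quotient.mk P.1 a) :=
  IsLocalization.lift_eq _ a

/-- The integral closure of `A` in the multiplier ring is finite over `A` as soon as no non-zero
nilpotent kills suitable elements `x i` of `E`: the integral closure embeds into the product of
`E^ι` and of the normalizations of the irreducible components. -/
theorem finite_integralMultiplierRing [IsNoetherianRing A] [Module.IsTorsionFree A E]
    (hN : HasFiniteNormalizations.{v} A) {ι : Type*} [IsNoetherian A (ι → E)] (x : ι → E)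
    (hx : ∀ a : A, IsNilpotent a → (∀ i, a • x i = 0) → a = 0) :
    Module.Finite A (integralMultiplierRing (A := A) E) := by
  have hfin : Finite (minimalPrimes A) := (minimalPrimes.finite_of_isNoetherianRing A).to_subtype
  let j : E →ₗ[A] Localization A⁰ ⊗[A] E := TensorProduct.mk A (Localization A⁰) E 1
  have hj : Function.Injective j := one_tmul_injective
  -- the action on the elements `x i`
  have h1 (b : integralMultiplierRing (A := A) E) (i : ι) :
      ∃ e : E, j e = (b : Localization A⁰) ⊗ₜ[A] x i := by
    obtain ⟨e, he⟩ := b.2.1 (x i)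
    exact ⟨e, he.symm⟩
  choose φ hφ using h1
  let Φ : integralMultiplierRing (A := A) E →ₗ[A] (ι → E) :=
    { toFun := φ
      map_add' := fun b c => funext fun i => hj (by
        simp [hφ, TensorProduct.add_tmul])
      map_smul' := fun a b => funext fun i => hj (by
        simp [hφ, TensorProduct.smul_tmul']) }
  -- the images in the normalizations of the irreducible components
  have h2 (b : integralMultiplierRing (A := A) E) (P : minimalPrimes A) :
      toResidueFraction P b ∈ integralClosure (A ⧸ P.1) (FractionRing (A ⧸ P.1)) := by
    obtain ⟨p, hp, hpb⟩ := b.2.2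
    refine ⟨p.map (Ideal.Quotient.mk P.1), hp.map _, ?_⟩
    rw [Polynomial.eval₂_map]
    have h3 : (algebraMap (A ⧸ P.1) (FractionRing (A ⧸ P.1))).comp (Ideal.Quotient.mk P.1) =
        (toResidueFraction P).comp (algebraMap A (Localization A⁰)) :=
      RingHom.ext fun a => (toResidueFraction_algebraMap P a).symm
    rw [h3, ← Polynomial.hom_eval₂, hpb, map_zero]
  let Ψ : integralMultiplierRing (A := A) E →ₗ[A]
      ((P : minimalPrimes A) → integralClosure (A ⧸ P.1) (FractionRing (A ⧸ P.1))) :=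
    { toFun := fun b P => ⟨toResidueFraction P b, h2 b P⟩
      map_add' := fun b c => funext fun P => Subtype.ext (by simp)
      map_smul' := fun a b => funext fun P => Subtype.ext (by
        simp only [Algebra.smul_def, RingHom.id_apply, Subalgebra.coe_mul, map_mul,
          Subalgebra.coe_algebraMap, Pi.mul_apply, toResidueFraction_algebraMap]
        rfl) }
  have hnoeth (P : minimalPrimes A) :
      IsNoetherian A (integralClosure (A ⧸ P.1) (FractionRing (A ⧸ P.1))) := by
    have := hN (A ⧸ P.1) (FractionRing (A ⧸ P.1)) (Ideal.Quotient.mk P.1)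
      Ideal.Quotient.mk_surjective
    have : Module.Finite A (integralClosure (A ⧸ P.1) (FractionRing (A ⧸ P.1))) :=
      Module.Finite.trans (A ⧸ P.1) _
    exact isNoetherian_of_isNoetherianRing_of_finite A _
  refine Module.Finite.of_injective (Φ.prod Ψ) ?_
  rw [injective_iff_map_eq_zero]
  intro b hb
  -- the numerator of an element of the kernel is nilpotent and kills all `x i`
  obtain ⟨a, s, has⟩ := IsLocalization.exists_mk'_eq A⁰ (b : Localization A⁰)
  have hbs : (b : Localization A⁰) * algebraMap A _ (s : A) = algebraMap A _ a := by
    rw [← has, IsLocalization.mk'_spec]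
  have hnil : IsNilpotent a := by
    rw [← mem_nilradical, nilradical, ← Ideal.sInf_minimalPrimes, Ideal.mem_sInf]
    intro P hP
    have h3 : toResidueFraction ⟨P, hP⟩ b = 0 :=
      congrArg Subtype.val (congrFun (congrArg Prod.snd hb) ⟨P, hP⟩)
    have h4 := congrArg (toResidueFraction ⟨P, hP⟩) hbs
    rw [map_mul, h3, zero_mul, toResidueFraction_algebraMap] at h4
    exact Ideal.Quotient.eq_zero_iff_mem.1
      ((FaithfulSMul.algebraMap_eq_zero_iff _ _).1 h4.symm)
  have hkill (i : ι) : a • x i = 0 := by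
    apply hj
    have h3 : φ b i = 0 := congrFun (congrArg Prod.fst hb) i
    have h4 := hφ b i
    rw [h3, map_zero] at h4
    rw [map_zero, map_smul, TensorProduct.mk_apply, TensorProduct.smul_tmul',
      ← Algebra.algebraMap_eq_smul_one, ← hbs, mul_comm, ← Algebra.smul_def,
      ← TensorProduct.smul_tmul', ← h4, smul_zero]
  have ha := hx a hnil hkill
  apply Subtype.ext
  rw [← has, ha, IsLocalization.mk'_zero]
  rfl

/-- Over a Noetherian ring `A` with finite normalizations, the integral closure of `A` in the
multiplier ring of a torsion-free module `E` is the maximal saturating modification: every finite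
modification for which `E` is saturated is integral over `A` and lies in the multiplier ring. -/
theorem exists_isMaximalSaturatingModification [IsNoetherianRing A] [Module.IsTorsionFree A E]
    (hN : HasFiniteNormalizations.{v} A)
    (h : IsReduced A ∨ (Module.Finite A E ∧
      ∀ a : A, IsNilpotent a → (∀ e : E, a • e = 0) → a = 0)) :
    IsMaximalSaturatingModification A (integralMultiplierRing (A := A) E) E := by
  have hfin : Module.Finite A (integralMultiplierRing (A := A) E) := by
    rcases h with h | ⟨h, hE⟩
    · -- without nilpotents the action on `E` is not needed for injectivity
      exact finite_integralMultiplierRing E hN (ι := Empty) Empty.elim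
        fun a ha _ => ha.eq_zero
    · obtain ⟨m, x, hx⟩ := Module.Finite.exists_fin (R := A) (M := E)
      refine finite_integralMultiplierRing E hN x fun a ha hax => hE a ha fun e => ?_
      have he : e ∈ Submodule.span A (Set.range x) := hx ▸ Submodule.mem_top
      induction he using Submodule.span_induction with
      | mem y hy =>
        obtain ⟨i, rfl⟩ := hy
        exact hax i
      | zero => exact smul_zero a
      | add y z _ _ hy hz => rw [smul_add, hy, hz, add_zero]
      | smul r y _ hy => rw [smul_comm, hy, smul_zero]
  have hB := IsFiniteModification.of_subalgebra (integralMultiplierRing (A := A) E)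
  refine ⟨hB, (hB.isSaturated_iff (Subalgebra.val _)).2 fun c e => c.2.1 e,
    fun C _ _ hC hsat => ?_⟩
  obtain ⟨ι⟩ := hC.nonempty_algHom_localization
  have := hC.finite
  have hmem (c : C) : ι c ∈ integralMultiplierRing (A := A) E :=
    ⟨(hC.isSaturated_iff ι).1 hsat c, (Algebra.IsIntegral.isIntegral c).map ι⟩
  exact ⟨ι.codRestrict _ hmem⟩

/-- Maximal saturating modifications are unique up to isomorphism. -/
theorem IsMaximalSaturatingModification.nonempty_algEquiv {E : Type w} [AddCommGroup E]
    [Module A E] {B B' : Type v} [CommRing B]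
    [CommRing B'] [Algebra A B] [Algebra A B'] (h : IsMaximalSaturatingModification A B E)
    (h' : IsMaximalSaturatingModification A B' E) : Nonempty (B' ≃ₐ[A] B) := by
  obtain ⟨φ⟩ := h.factors B' h'.isFiniteModification h'.isSaturated
  obtain ⟨ψ⟩ := h'.factors B h.isFiniteModification h.isSaturated
  exact ⟨AlgEquiv.ofAlgHom φ ψ
    (h.isFiniteModification.algHom_ext h.isFiniteModification _ _)
    (h'.isFiniteModification.algHom_ext h'.isFiniteModification _ _)⟩

end Multipliers

/-! ### Kernels of determinantal representations -/

section Determinantal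

variable {O : Type v} [CommRing O]

theorem mem_relAdjointIdeal_iff {f : O} {B : Type w} [CommRing B] [Algebra (HypersurfaceRing f) B]
    {g : O} : g ∈ relAdjointIdeal f B ↔ ∀ b : B, ∃ a : HypersurfaceRing f,
      b * algebraMap (HypersurfaceRing f) B (Ideal.Quotient.mk _ g) = algebraMap _ B a := by
  rw [relAdjointIdeal, Ideal.mem_comap, relConductor, Module.mem_annihilator]
  constructor
  · intro h b
    have := h (Submodule.Quotient.mk b)
    rw [← Submodule.Quotient.mk_smul, Submodule.Quotient.mk_eq_zero] at this
    obtain ⟨a, ha⟩ := this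
    exact ⟨a, by rw [mul_comm, ← Algebra.smul_def, ← ha]; rfl⟩
  · intro h b
    obtain ⟨b, rfl⟩ := Submodule.Quotient.mk_surjective _ b
    obtain ⟨a, ha⟩ := h b
    rw [← Submodule.Quotient.mk_smul, Submodule.Quotient.mk_eq_zero]
    exact ⟨a, by rw [Algebra.smul_def, mul_comm, ha]; rfl⟩

/-- The matrix factorization `M · adj M = f` identifies the kernel of `M` over `O/(f)` with the
image of `adj M`. -/
theorem mem_kernelModule_iff [IsDomain O] {f : O} (hf : f ≠ 0) {d : ℕ}
    {M : Matrix (Fin d) (Fin d) O} (hM : M.det = f) (x : Fin d → HypersurfaceRing f) :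
    x ∈ kernelModule f M ↔
      ∃ y, x = (M.adjugate.map (Ideal.Quotient.mk (Ideal.span {f}))).mulVec y := by
  set π := Ideal.Quotient.mk (Ideal.span {f}) with hπ
  have hvec (N : Matrix (Fin d) (Fin d) O) (z : Fin d → O) :
      (N.map π).mulVec (π ∘ z) = π ∘ (N.mulVec z) := by
    funext i
    simp [Matrix.mulVec, dotProduct]
  have hlift (z : Fin d → HypersurfaceRing f) : ∃ z' : Fin d → O, z = π ∘ z' :=
    ⟨fun i => (Ideal.Quotient.mk_surjective (z i)).choose,
      funext fun i => (Ideal.Quotient.mk_surjective (z i)).choose_spec.symm⟩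
  rw [LinearMap.mem_ker, Matrix.mulVecLin_apply]
  constructor
  · intro h
    obtain ⟨v, rfl⟩ := hlift x
    rw [← hπ, hvec] at h
    have hdvd (i) : ∃ c, M.mulVec v i = f * c := by
      have := congrFun h i
      exact Ideal.mem_span_singleton.1 (Ideal.Quotient.eq_zero_iff_mem.1 this)
    choose y hy using hdvd
    refine ⟨π ∘ y, ?_⟩
    rw [hvec]
    congr 1
    have h1 : M.mulVec (v - M.adjugate.mulVec y) = 0 := by
      rw [Matrix.mulVec_sub, Matrix.mulVec_mulVec, Matrix.mul_adjugate, hM]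
      funext i
      simp [hy, Matrix.smul_mulVec]
    exact sub_eq_zero.1 (Matrix.eq_zero_of_mulVec_eq_zero (hM ▸ hf) h1)
  · rintro ⟨y, rfl⟩
    obtain ⟨z, rfl⟩ := hlift y
    rw [← hπ, hvec, hvec, Matrix.mulVec_mulVec, Matrix.mul_adjugate, hM]
    funext i
    have : π f = 0 := Ideal.Quotient.eq_zero_iff_mem.2 (Ideal.mem_span_singleton_self f)
    simp [this, Matrix.smul_mulVec]

/-- As `E = ker M` is the image of `adj M`, the inclusion `B·E ⊆ E` says that `B` multiplies the
entries of `adj M` into `O/(f)`; the resulting vectors lie in `ker M` automatically. -/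
theorem isSaturated_kernelModule_iff [IsDomain O] {f : O} (hf : f ≠ 0) {d : ℕ}
    {M : Matrix (Fin d) (Fin d) O} (hM : M.det = f) {B : Type w} [CommRing B]
    [Algebra (HypersurfaceRing f) B] (hB : IsFiniteModification (HypersurfaceRing f) B) :
    IsSaturated (HypersurfaceRing f) B (kernelModule f M) ↔ IsSaturatedDetRep f B M := by
  set π := Ideal.Quotient.mk (Ideal.span {f}) with hπ
  rw [hB.isSaturated_submodule_iff]
  simp only [IsSaturatedDetRep, mem_relAdjointIdeal_iff]
  constructor
  · intro h i j b
    obtain ⟨e', -, he'⟩ := h b ((M.adjugate.map π).mulVec (Pi.single j 1))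
      ((mem_kernelModule_iff hf hM _).2 ⟨_, rfl⟩)
    exact ⟨e' i, by simpa using he' i⟩
  · intro h b e he
    obtain ⟨y, rfl⟩ := (mem_kernelModule_iff hf hM e).1 he
    choose a ha using fun i j => h i j b
    have hval (i : Fin d) : b * algebraMap _ B ((M.adjugate.map π).mulVec y i) =
        algebraMap _ B (∑ j, a i j * y j) := by
      simp only [Matrix.mulVec, dotProduct, map_sum, map_mul, Finset.mul_sum, Matrix.map_apply,
        ← ha, mul_assoc, hπ]
    refine ⟨fun i => ∑ j, a i j * y j, ?_, hval⟩
    rw [LinearMap.mem_ker, Matrix.mulVecLin_apply] at he ⊢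
    funext i
    apply hB.algebraMap_injective
    have := congrArg (algebraMap _ B) (congrFun he i)
    simp only [Matrix.mulVec, dotProduct, map_sum, map_mul, Pi.zero_apply, map_zero] at this hval ⊢
    simp only [← hval]
    rw [← mul_zero b, ← this, Finset.mul_sum]
    exact Finset.sum_congr rfl fun j _ => by ring

/-- The adjugate of the transpose is the transpose of the adjugate. -/
theorem isSaturatedDetRep_transpose {f : O} {d : ℕ} {M : Matrix (Fin d) (Fin d) O} {B : Type w}
    [CommRing B] [Algebra (HypersurfaceRing f) B] :
    IsSaturatedDetRep f B M.transpose ↔ IsSaturatedDetRep f B M := by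
  simp only [IsSaturatedDetRep, ← Matrix.adjugate_transpose, Matrix.transpose_apply]
  exact forall_comm

end Determinantal

/-! ### Finiteness of normalizations along finite extensions, and the algebraic case -/

/-- In characteristic zero, finiteness of the normalization ascends along finite extensions of
Noetherian domains. -/
theorem finite_integralClosure_of_finite {D₀ K₀ D K : Type*} [CommRing D₀] [IsDomain D₀]
    [IsNoetherianRing D₀] [CharZero D₀] [Field K₀] [Algebra D₀ K₀] [IsFractionRing D₀ K₀]
    [CommRing D] [IsDomain D] [Algebra D₀ D] [Module.Finite D₀ D]
    [FaithfulSMul D₀ D] [Field K] [Algebra D K] [IsFractionRing D K]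
    [Algebra D₀ K] [IsScalarTower D₀ D K]
    (h : Module.Finite D₀ (integralClosure D₀ K₀)) :
    Module.Finite D₀ (integralClosure D K) := by
  have hinj : Function.Injective (algebraMap D₀ K) := by
    rw [IsScalarTower.algebraMap_eq D₀ D K]
    exact (IsFractionRing.injective D K).comp (FaithfulSMul.algebraMap_injective D₀ D)
  have : FaithfulSMul D₀ K := (faithfulSMul_iff_algebraMap_injective D₀ K).2 hinj
  let _ : Algebra K₀ K := (IsFractionRing.lift hinj).toAlgebra
  have : IsScalarTower D₀ K₀ K := IsScalarTower.of_algebraMap_eq fun x =>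
    (IsFractionRing.lift_algebraMap hinj x).symm
  have : CharZero K₀ := charZero_of_injective_algebraMap (IsFractionRing.injective D₀ K₀)
  have : FiniteDimensional K₀ K := Module.Finite.of_isLocalization D₀ D D₀⁰
  -- `K / K₀` is finite separable, so the integral closure in `K` of the normalization `N` of `D₀`
  -- is finite over `N`
  let N := integralClosure D₀ K₀
  have : IsFractionRing N K₀ := 
    integralClosure.isFractionRing_of_finite_extension K₀ K₀
  have : IsNoetherianRing N := isNoetherian_of_tower D₀ inferInstance
  have : IsIntegrallyClosed N := integralClosure.isIntegrallyClosedOfFiniteExtension K₀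
  have hfin : Module.Finite N (integralClosure N K) := IsIntegralClosure.finite N K₀ K _
  have : Module.Finite D₀ (integralClosure N K) := Module.Finite.trans N _
  have hle (x : integralClosure D K) : (x : K) ∈ integralClosure N K := by
    have h1 : IsIntegral D₀ (x : K) := isIntegral_trans (R := D₀) (A := D) _ x.2
    exact h1.tower_top
  let Φ : integralClosure D K →ₗ[D₀] integralClosure N K :=
    { toFun := fun x => ⟨x, hle x⟩
      map_add' := fun x y => rfl
      map_smul' := fun a x => rfl }
  exact Module.Finite.of_injective Φ fun x y hxy =>
    Subtype.ext (congrArg (fun z : integralClosure N K => (z : K)) hxy)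

theorem finite_integralClosure_of_isIntegrallyClosed (D K : Type*) [CommRing D] [IsDomain D]
    [IsIntegrallyClosed D] [Field K] [Algebra D K] [IsFractionRing D K] :
    Module.Finite D (integralClosure D K) := by
  rw [(IsIntegrallyClosed.integralClosure_eq_bot_iff K).2 inferInstance]
  infer_instance

/-- Noether normalization: domains of finite type over a field of characteristic zero have finite
normalizations. -/
theorem finite_integralClosure_of_finiteType (k D K : Type*) [Field k] [CharZero k] [CommRing D]
    [IsDomain D] [Algebra k D] [Algebra.FiniteType k D] [Field K] [Algebra D K]
    [IsFractionRing D K] : Module.Finite D (integralClosure D K) := by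
  obtain ⟨s, g, hg, hfin⟩ := exists_finite_inj_algHom_of_fg k D
  let _ : Algebra (MvPolynomial (Fin s) k) D := g.toRingHom.toAlgebra
  let _ : Algebra (MvPolynomial (Fin s) k) K := ((algebraMap D K).comp g.toRingHom).toAlgebra
  have : IsScalarTower (MvPolynomial (Fin s) k) D K := IsScalarTower.of_algebraMap_eq fun _ => rfl
  have : FaithfulSMul (MvPolynomial (Fin s) k) D :=
    (faithfulSMul_iff_algebraMap_injective _ _).2 hg
  have : Module.Finite (MvPolynomial (Fin s) k) D := hfin
  have : CharZero (MvPolynomial (Fin s) k) := inferInstance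
  have := finite_integralClosure_of_finite (D := D) (K := K)
    (finite_integralClosure_of_isIntegrallyClosed (MvPolynomial (Fin s) k)
      (FractionRing (MvPolynomial (Fin s) k)))
  exact Module.Finite.of_restrictScalars_finite (MvPolynomial (Fin s) k) D _

/-- Finiteness of the normalization is preserved by localization. -/
theorem finite_integralClosure_of_isLocalization {D₀ D K : Type*} [CommRing D₀] [IsDomain D₀]
    [CommRing D] [IsDomain D] [Algebra D₀ D] (M : Submonoid D₀) [IsLocalization M D]
    [Field K] [Algebra D K] [Algebra D₀ K] [IsScalarTower D₀ D K]
    (h : Module.Finite D₀ (integralClosure D₀ K)) :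
    Module.Finite D (integralClosure D K) := by
  let Φ : integralClosure D₀ K →ₗ[D₀] integralClosure D K :=
    { toFun := fun x => ⟨x, x.2.tower_top⟩
      map_add' := fun x y => rfl
      map_smul' := fun a x => rfl }
  obtain ⟨S, hS⟩ := (Module.Finite.fg_top : (⊤ : Submodule D₀ (integralClosure D₀ K)).FG)
  classical
  refine ⟨⟨S.image Φ, eq_top_iff.2 fun x _ => ?_⟩⟩
  -- an integral element over `D` becomes integral over `D₀` after multiplication by a unit of `D`
  obtain ⟨m, hm⟩ := IsIntegral.exists_multiple_integral_of_isLocalization M (x : K) x.2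
  have hmem : Φ ⟨m • (x : K), hm⟩ ∈ Submodule.span D (S.image Φ : Set (integralClosure D K)) := by
    have h1 : (⟨m • (x : K), hm⟩ : integralClosure D₀ K) ∈ Submodule.span D₀ (S : Set _) :=
      hS ▸ Submodule.mem_top
    have h2 := Submodule.mem_map_of_mem (f := Φ) h1
    rw [Submodule.map_span, ← Finset.coe_image] at h2
    exact Submodule.span_le_restrictScalars D₀ D _ h2
  have hu : IsUnit (algebraMap D₀ D m) := IsLocalization.map_units D m
  have h3 : algebraMap D₀ D m • x = Φ ⟨m • (x : K), hm⟩ := Subtype.ext (by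
    change algebraMap D₀ D m • (x : K) = (m : D₀) • (x : K)
    rw [algebraMap_smul])
  rw [← h3] at hmem
  have := Submodule.smul_mem _ (↑hu.unit⁻¹ : D) hmem
  rwa [smul_smul, IsUnit.val_inv_mul, one_smul] at this

/-- A quotient domain of a localized polynomial ring is a localization of a domain of finite type
over `k`. -/
theorem hasFiniteNormalizations_localization {k : Type u} [Field k] [CharZero k] (n : ℕ)
    (P : Ideal (MvPolynomial (Fin n) k)) [P.IsPrime] :
    HasFiniteNormalizations.{w} (Localization.AtPrime P) := by
  intro D K _ _ _ _ _ π hπ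
  let g : MvPolynomial (Fin n) k →+* D := π.comp (algebraMap _ _)
  have hsurj (d : D) : ∃ p, ∃ s ∈ P.primeCompl, d * g s = g p := by
    obtain ⟨x, rfl⟩ := hπ d
    obtain ⟨p, s, rfl⟩ := IsLocalization.exists_mk'_eq P.primeCompl x
    exact ⟨p, s, s.2, by rw [RingHom.comp_apply, ← map_mul, IsLocalization.mk'_spec]; rfl⟩
  have hunit (s) (hs : s ∈ P.primeCompl) : IsUnit (g s) :=
    (IsLocalization.map_units (Localization.AtPrime P) (⟨s, hs⟩ : P.primeCompl)).map π
  have hloc : IsLocalization (P.primeCompl.map g.rangeRestrict) D := by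
    refine ⟨?_, fun d => ?_, fun {x y} hxy => ⟨1, by rw [Subtype.ext hxy]⟩⟩
    · rintro ⟨_, s, hs, rfl⟩
      exact hunit s hs
    · obtain ⟨p, s, hs, h⟩ := hsurj d
      exact ⟨⟨g.rangeRestrict p, g.rangeRestrict s, s, hs, rfl⟩, h⟩
  let _ : Algebra k g.range := (g.rangeRestrict.comp MvPolynomial.C).toAlgebra
  have hft : Algebra.FiniteType k g.range := by
    let g' : MvPolynomial (Fin n) k →ₐ[k] g.range := ⟨g.rangeRestrict, fun _ => rfl⟩
    exact Algebra.FiniteType.of_surjective g' g.rangeRestrict_surjective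
  have : FaithfulSMul g.range K := (faithfulSMul_iff_algebraMap_injective _ _).2
    ((IsFractionRing.injective D K).comp Subtype.val_injective)
  have : IsFractionRing g.range K := IsFractionRing.of_field _ _ fun z => by
    obtain ⟨d, e, he, rfl⟩ := IsFractionRing.div_surjective (A := D) z
    obtain ⟨p, s, hs, h⟩ := hsurj d
    obtain ⟨q, t, ht, h'⟩ := hsurj e
    refine ⟨g.rangeRestrict (p * t), g.rangeRestrict (q * s), ?_⟩
    change algebraMap D K d / algebraMap D K e =
      algebraMap D K (g (p * t)) / algebraMap D K (g (q * s))
    have hs0 : algebraMap D K (g s) ≠ 0 := ((hunit s hs).map (algebraMap D K)).ne_zero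
    have ht0 : algebraMap D K (g t) ≠ 0 := ((hunit t ht).map (algebraMap D K)).ne_zero
    have he0 : algebraMap D K e ≠ 0 := fun h0 => nonZeroDivisors.ne_zero he
      ((FaithfulSMul.algebraMap_eq_zero_iff D K).1 h0)
    rw [map_mul g, map_mul g, ← h, ← h']
    simp only [map_mul]
    field_simp
  exact finite_integralClosure_of_isLocalization (D₀ := g.range)
    (P.primeCompl.map g.rangeRestrict) (finite_integralClosure_of_finiteType k g.range K)

/-! ### Norms of power series on polydiscs -/

/-- The value `∏ ρᵢ ^ mᵢ` of the monomial with exponent `m` at the point `ρ`. -/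
def monomialValue {n : ℕ} {M : Type*} [CommMonoid M] (ρ : Fin n → M) (m : Fin n →₀ ℕ) : M :=
  ∏ i, ρ i ^ m i

section MonomialValue

variable {n : ℕ} {M : Type*} [CommMonoid M] (ρ : Fin n → M)

@[simp]
theorem monomialValue_zero : monomialValue ρ 0 = 1 := by simp [monomialValue]

theorem monomialValue_add (a b : Fin n →₀ ℕ) :
    monomialValue ρ (a + b) = monomialValue ρ a * monomialValue ρ b := by
  simp [monomialValue, pow_add, Finset.prod_mul_distrib]

theorem monomialValue_single (i : Fin n) (e : ℕ) :
    monomialValue ρ (Finsupp.single i e) = ρ i ^ e := by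
  classical
  rw [monomialValue, Finset.prod_eq_single i]
  · simp
  · intro j _ hj
    simp [hj.symm]
  · simp

theorem monomialValue_const (r : M) (m : Fin n →₀ ℕ) :
    monomialValue (fun _ => r) m = r ^ m.degree := by
  rw [monomialValue, Finset.prod_pow_eq_pow_sum, Finsupp.degree_eq_sum]

theorem monomialValue_pow (s : ℕ) (m : Fin n →₀ ℕ) :
    monomialValue (fun i => ρ i ^ s) m = monomialValue ρ m ^ s := by
  rw [monomialValue, monomialValue, ← Finset.prod_pow]
  exact Finset.prod_congr rfl fun i _ => by rw [← pow_mul, ← pow_mul, mul_comm]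

end MonomialValue

theorem monomialValue_mono {n : ℕ} {ρ ρ' : Fin n → ℝ≥0∞} (h : ρ ≤ ρ') (m : Fin n →₀ ℕ) :
    monomialValue ρ m ≤ monomialValue ρ' m :=
  Finset.prod_le_prod' fun i _ => pow_le_pow_left' (h i) _

section PolyNorm

variable {k : Type u} [NormedField k] {n : ℕ}

/-- The norm `∑ |p_m| ρ^m` of a power series on the polydisc of radius `ρ`, possibly infinite. -/
noncomputable def polyNorm (ρ : Fin n → ℝ≥0∞) (p : MvPowerSeries (Fin n) k) : ℝ≥0∞ :=
  ∑' m, ‖MvPowerSeries.coeff m p‖ₑ * monomialValue ρ m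

variable (ρ : Fin n → ℝ≥0∞)

@[simp]
theorem polyNorm_zero : polyNorm ρ (0 : MvPowerSeries (Fin n) k) = 0 := by simp [polyNorm]

theorem polyNorm_add_le (p q : MvPowerSeries (Fin n) k) :
    polyNorm ρ (p + q) ≤ polyNorm ρ p + polyNorm ρ q := by
  rw [polyNorm, polyNorm, polyNorm, ← ENNReal.tsum_add]
  refine ENNReal.tsum_le_tsum fun m => ?_
  rw [← add_mul, map_add]
  gcongr
  exact enorm_add_le _ _

theorem polyNorm_neg (p : MvPowerSeries (Fin n) k) : polyNorm ρ (-p) = polyNorm ρ p := by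
  simp [polyNorm]

theorem polyNorm_sub_le (p q : MvPowerSeries (Fin n) k) :
    polyNorm ρ (p - q) ≤ polyNorm ρ p + polyNorm ρ q := by
  rw [sub_eq_add_neg, ← polyNorm_neg ρ q]
  exact polyNorm_add_le ρ _ _

theorem polyNorm_sum_le {ι : Type*} (s : Finset ι) (p : ι → MvPowerSeries (Fin n) k) :
    polyNorm ρ (∑ i ∈ s, p i) ≤ ∑ i ∈ s, polyNorm ρ (p i) :=
  Finset.le_sum_of_subadditive _ (polyNorm_zero ρ).le (polyNorm_add_le ρ) s p

theorem polyNorm_mul_le (p q : MvPowerSeries (Fin n) k) :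
    polyNorm ρ (p * q) ≤ polyNorm ρ p * polyNorm ρ q := by
  classical
  calc polyNorm ρ (p * q)
      ≤ ∑' m, ∑ x ∈ Finset.HasAntidiagonal.antidiagonal m,
          (‖MvPowerSeries.coeff x.1 p‖ₑ * monomialValue ρ x.1) *
            (‖MvPowerSeries.coeff x.2 q‖ₑ * monomialValue ρ x.2) := by
        refine ENNReal.tsum_le_tsum fun m => ?_
        rw [MvPowerSeries.coeff_mul]
        refine (mul_le_mul_left (enorm_sum_le _ _) _).trans (le_of_eq ?_)
        rw [Finset.sum_mul]
        refine Finset.sum_congr rfl fun x hx => ?_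
        rw [← Finset.HasAntidiagonal.mem_antidiagonal.mp hx, monomialValue_add, enorm_mul]
        ring
    _ = ∑' x : (Fin n →₀ ℕ) × (Fin n →₀ ℕ), (‖MvPowerSeries.coeff x.1 p‖ₑ * monomialValue ρ x.1) *
            (‖MvPowerSeries.coeff x.2 q‖ₑ * monomialValue ρ x.2) := by
        rw [← (Finset.HasAntidiagonal.sigmaAntidiagonalEquivProd (A := Fin n →₀ ℕ)).tsum_eq,
          ENNReal.tsum_sigma']
        refine tsum_congr fun m => ?_
        rw [← Finset.tsum_subtype]
        rfl
    _ = polyNorm ρ p * polyNorm ρ q := by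
        rw [ENNReal.tsum_prod', polyNorm, polyNorm, ← ENNReal.tsum_mul_right]
        exact tsum_congr fun a => by rw [← ENNReal.tsum_mul_left]

theorem polyNorm_monomial (m : Fin n →₀ ℕ) (a : k) :
    polyNorm ρ (MvPowerSeries.monomial m a) = ‖a‖ₑ * monomialValue ρ m := by
  classical
  rw [polyNorm, tsum_eq_single m]
  · rw [MvPowerSeries.coeff_monomial_same]
  · intro m' hm'
    rw [MvPowerSeries.coeff_monomial_ne hm', enorm_zero, zero_mul]

theorem polyNorm_C (a : k) : polyNorm ρ (MvPowerSeries.C a) = ‖a‖ₑ := by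
  rw [← MvPowerSeries.monomial_zero_eq_C_apply, polyNorm_monomial, monomialValue_zero, mul_one]

theorem polyNorm_X (i : Fin n) :
    polyNorm ρ (MvPowerSeries.X i : MvPowerSeries (Fin n) k) = ρ i := by
  rw [MvPowerSeries.X, polyNorm_monomial, monomialValue_single, pow_one, enorm_one, one_mul]

theorem polyNorm_pow_le (p : MvPowerSeries (Fin n) k) (e : ℕ) :
    polyNorm ρ (p ^ e) ≤ polyNorm ρ p ^ e := by
  induction e with
  | zero => simpa using (polyNorm_C ρ (1 : k)).le
  | succ e ih =>
    rw [pow_succ, pow_succ]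
    exact (polyNorm_mul_le ρ _ _).trans (mul_le_mul_left ih _)

theorem polyNorm_prod_le {ι : Type*} (s : Finset ι) (p : ι → MvPowerSeries (Fin n) k) :
    polyNorm ρ (∏ i ∈ s, p i) ≤ ∏ i ∈ s, polyNorm ρ (p i) := by
  classical
  induction s using Finset.induction_on with
  | empty => simpa using (polyNorm_C ρ (1 : k)).le
  | insert a s ha ih =>
    rw [Finset.prod_insert ha, Finset.prod_insert ha]
    exact (polyNorm_mul_le ρ _ _).trans (mul_le_mul_right ih _)

theorem polyNorm_mono {ρ ρ' : Fin n → ℝ≥0∞} (h : ρ ≤ ρ') (p : MvPowerSeries (Fin n) k) :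
    polyNorm ρ p ≤ polyNorm ρ' p :=
  ENNReal.tsum_le_tsum fun m => mul_le_mul_right (monomialValue_mono h m) _

/-- Convergence can be tested on polydiscs with different radii. -/
theorem isConvergent_iff_polyNorm {p : MvPowerSeries (Fin n) k} :
    IsConvergent p ↔ ∃ ρ : Fin n → ℝ≥0∞, (∀ i, ρ i ≠ 0) ∧ polyNorm ρ p ≠ ⊤ := by
  constructor
  · rintro ⟨r, hr, h⟩
    refine ⟨fun _ => ENNReal.ofReal r, fun _ => (ENNReal.ofReal_pos.2 hr).ne', ?_⟩
    have := h.tsum_ofReal_ne_top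
    convert this using 1
    refine tsum_congr fun m => ?_
    rw [monomialValue_const, ENNReal.ofReal_mul (norm_nonneg _), ENNReal.ofReal_pow hr.le,
      ofReal_norm]
  · rintro ⟨ρ, hρ, h⟩
    let t : ℝ≥0∞ := Finset.univ.inf ρ ⊓ 1
    have ht1 : t ≠ ⊤ := ne_top_of_le_ne_top ENNReal.one_ne_top inf_le_right
    have ht0 : 0 < t := by
      refine lt_inf_iff.2 ⟨(Finset.lt_inf_iff ENNReal.zero_lt_top).2 fun i _ => ?_, one_pos⟩
      exact pos_iff_ne_zero.2 (hρ i)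
    have hle : (fun _ => t) ≤ ρ := fun i => inf_le_left.trans (Finset.inf_le (Finset.mem_univ i))
    refine ⟨t.toReal, ENNReal.toReal_pos ht0.ne' ht1, ?_⟩
    have := ENNReal.summable_toReal (ne_top_of_le_ne_top h (polyNorm_mono hle p))
    convert this using 2 with m
    rw [monomialValue_const, ENNReal.toReal_mul, ENNReal.toReal_pow, toReal_enorm]

/-- The polyradius `wᵢ ^ (-s)`, which shrinks to zero for `s → ∞`. On it the monomial with
exponent `m` has the value `(∏ wᵢ ^ mᵢ) ^ (-s)`. -/
noncomputable def weightRadius (w : Fin n → ℕ) (s : ℕ) : Fin n → ℝ≥0∞ :=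
  fun i => (w i : ℝ≥0∞)⁻¹ ^ s

theorem monomialValue_weightRadius (w : Fin n → ℕ) (s : ℕ) (m : Fin n →₀ ℕ) :
    monomialValue (weightRadius w s) m = ((monomialValue w m : ℕ) : ℝ≥0∞)⁻¹ ^ s := by
  have h : ((monomialValue w m : ℕ) : ℝ≥0∞)⁻¹ = monomialValue (fun i => (w i : ℝ≥0∞)⁻¹) m := by
    rw [monomialValue, monomialValue, Nat.cast_prod, ENNReal.prod_inv_distrib]
    · exact Finset.prod_congr rfl fun i _ => by rw [Nat.cast_pow, ENNReal.inv_pow]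
    · intro i _ j _ _
      exact Or.inr (ENNReal.natCast_ne_top _)
  rw [h]
  exact monomialValue_pow _ s m

theorem weightRadius_ne_zero (w : Fin n → ℕ) (s : ℕ) (i : Fin n) : weightRadius w s i ≠ 0 :=
  pow_ne_zero _ (ENNReal.inv_ne_zero.2 (ENNReal.natCast_ne_top _))

theorem IsConvergent.eventually_polyNorm_ne_top {p : MvPowerSeries (Fin n) k}
    (hp : IsConvergent p) {w : Fin n → ℕ} (hw : ∀ i, 1 < w i) :
    ∀ᶠ s in Filter.atTop, polyNorm (weightRadius w s) p ≠ ⊤ := by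
  obtain ⟨ρ, hρ, h⟩ := isConvergent_iff_polyNorm.1 hp
  have h1 (i : Fin n) : ∀ᶠ s in Filter.atTop, weightRadius w s i ≤ ρ i := by
    have h2 : (w i : ℝ≥0∞)⁻¹ < 1 := ENNReal.inv_lt_one.2 (by exact_mod_cast hw i)
    have h3 := ENNReal.tendsto_pow_atTop_nhds_zero_of_lt_one h2
    exact (h3.eventually_lt_const (pos_iff_ne_zero.2 (hρ i))).mono fun s hs => hs.le
  filter_upwards [Filter.eventually_all.2 h1] with s hs
  exact ne_top_of_le_ne_top h (polyNorm_mono hs p)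

theorem isConvergent_of_polyNorm_weightRadius {p : MvPowerSeries (Fin n) k} {w : Fin n → ℕ} {s : ℕ}
    (h : polyNorm (weightRadius w s) p ≠ ⊤) : IsConvergent p :=
  isConvergent_iff_polyNorm.2 ⟨_, weightRadius_ne_zero w s, h⟩

end PolyNorm

/-! ### Leading exponents -/

section Lead

variable {k : Type u} [Field k] {n : ℕ} {w : Fin n → ℕ}

/-- Distinct primes as weights make the value of a monomial determine its exponent. -/
theorem monomialValue_injective (hw : ∀ i, (w i).Prime) (hinj : Function.Injective w) :
    Function.Injective (monomialValue w) := by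
  have key (m : Fin n →₀ ℕ) (i : Fin n) : (monomialValue w m).factorization (w i) = m i := by
    rw [monomialValue, Nat.factorization_prod fun j _ => pow_ne_zero _ (hw j).ne_zero,
      Finset.sum_apply', Finset.sum_eq_single i]
    · simp [(hw i).factorization]
    · intro j _ hj
      simp [(hw j).factorization, hinj.ne hj]
    · simp
  intro a b hab
  ext i
  rw [← key a i, hab, key b i]

/-- `a` is the leading exponent of the power series `p`: the exponent with the smallest value at
`w` among those occurring in `p`. -/
def IsLeadingExponent (w : Fin n → ℕ) (p : MvPowerSeries (Fin n) k) (a : Fin n →₀ ℕ) : Prop :=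
  MvPowerSeries.coeff a p ≠ 0 ∧
    ∀ b, MvPowerSeries.coeff b p ≠ 0 → b ≠ a → monomialValue w a < monomialValue w b

theorem exists_isLeadingExponent (hw : Function.Injective (monomialValue w))
    {p : MvPowerSeries (Fin n) k} (hp : p ≠ 0) : ∃ a, IsLeadingExponent w p a := by
  have hne : {m | MvPowerSeries.coeff m p ≠ 0}.Nonempty := by
    by_contra h
    exact hp (MvPowerSeries.ext fun m => by
      by_contra hm
      exact h ⟨m, hm⟩)
  refine ⟨Function.argminOn (monomialValue w) _ hne, Function.argminOn_mem _ _ hne,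
    fun b hb hba => ?_⟩
  refine lt_of_le_of_ne (Function.argminOn_le _ _ hb) fun h => hba (hw h.symm)

theorem IsLeadingExponent.unique {p : MvPowerSeries (Fin n) k} {a b : Fin n →₀ ℕ}
    (ha : IsLeadingExponent w p a) (hb : IsLeadingExponent w p b) : a = b := by
  by_contra h
  exact lt_asymm (ha.2 b hb.1 (Ne.symm h)) (hb.2 a ha.1 h)

theorem IsLeadingExponent.mul (hw : ∀ i, 0 < w i) {p q : MvPowerSeries (Fin n) k}
    {a b : Fin n →₀ ℕ} (hp : IsLeadingExponent w p a) (hq : IsLeadingExponent w q b) :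
    IsLeadingExponent w (p * q) (a + b) := by
  classical
  have hpos (m) : 0 < monomialValue w m := Finset.prod_pos fun i _ => pow_pos (hw i) _
  -- a pair of exponents of `p` and `q` other than `(a, b)` has a larger value
  have key (x y : Fin n →₀ ℕ) (hx : MvPowerSeries.coeff x p ≠ 0)
      (hy : MvPowerSeries.coeff y q ≠ 0) (hxy : (x, y) ≠ (a, b)) :
      monomialValue w (a + b) < monomialValue w (x + y) := by
    rw [monomialValue_add, monomialValue_add]
    rcases eq_or_ne x a with rfl | hxa
    · have hyb : y ≠ b := fun h => hxy (by rw [h])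
      exact Nat.mul_lt_mul_of_pos_left (hq.2 y hy hyb) (hpos x)
    · have h1 := hp.2 x hx hxa
      rcases eq_or_ne y b with rfl | hyb
      · exact Nat.mul_lt_mul_of_pos_right h1 (hpos y)
      · exact Nat.mul_lt_mul'' h1 (hq.2 y hy hyb)
  constructor
  · rw [MvPowerSeries.coeff_mul, Finset.sum_eq_single (a, b)]
    · exact mul_ne_zero hp.1 hq.1
    · rintro ⟨x, y⟩ hxy hne
      by_contra h
      have := key x y (left_ne_zero_of_mul h) (right_ne_zero_of_mul h) hne
      rw [Finset.HasAntidiagonal.mem_antidiagonal.1 hxy] at this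
      exact lt_irrefl _ this
    · intro h
      exact absurd (by simp) h
  · intro c hc hne
    rw [MvPowerSeries.coeff_mul] at hc
    obtain ⟨⟨x, y⟩, hxy, h⟩ := Finset.exists_ne_zero_of_sum_ne_zero hc
    have hxy' := Finset.HasAntidiagonal.mem_antidiagonal.1 hxy
    rw [← hxy']
    refine key x y (left_ne_zero_of_mul h) (right_ne_zero_of_mul h) fun h' => hne ?_
    rw [← hxy', (Prod.mk.inj h').1, (Prod.mk.inj h').2]

theorem IsLeadingExponent.pow (hw : ∀ i, 0 < w i) {p : MvPowerSeries (Fin n) k}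
    {a : Fin n →₀ ℕ} (hp : IsLeadingExponent w p a) (e : ℕ) :
    IsLeadingExponent w (p ^ e) (e • a) := by
  classical
  induction e with
  | zero =>
    refine ⟨by simp, fun b hb hne => absurd ?_ hb⟩
    rw [pow_zero, MvPowerSeries.coeff_one, if_neg (by simpa using hne)]
  | succ e ih =>
    rw [pow_succ, succ_nsmul]
    exact ih.mul hw hp

end Lead

/-! ### Power series in some of the variables -/

section Supported

variable (k : Type u) {n : ℕ}

/-- The power series involving only the variables in `T`. -/
def supportedIn [Field k] (T : Finset (Fin n)) : Subalgebra k (MvPowerSeries (Fin n) k) where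
  carrier := {p | ∀ m, MvPowerSeries.coeff m p ≠ 0 → m.support ⊆ T}
  algebraMap_mem' a m hm := by
    classical
    rw [MvPowerSeries.algebraMap_apply, Algebra.algebraMap_self_apply, MvPowerSeries.coeff_C] at hm
    have : m = 0 := by
      by_contra h
      exact hm (if_neg h)
    simp [this]
  add_mem' {p q} hp hq m hm := by
    rw [map_add] at hm
    by_cases h : MvPowerSeries.coeff m p = 0
    · exact hq m (by simpa [h] using hm)
    · exact hp m h
  mul_mem' {p q} hp hq m hm := by
    classical
    rw [MvPowerSeries.coeff_mul] at hm
    obtain ⟨x, hx, h⟩ := Finset.exists_ne_zero_of_sum_ne_zero hm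
    rw [← Finset.HasAntidiagonal.mem_antidiagonal.1 hx]
    exact Finsupp.support_add.trans (Finset.union_subset (hp _ (left_ne_zero_of_mul h))
      (hq _ (right_ne_zero_of_mul h)))

/-- The convergent power series in the variables in `T`. -/
noncomputable def convergentIn [NormedField k] (T : Finset (Fin n)) :
    Subalgebra k (MvPowerSeries (Fin n) k) :=
  convergentPowerSeries k n ⊓ supportedIn k T

end Supported

/-! ### Division of power series -/

section Division

variable {k : Type u} {n : ℕ} {ι : Type*}

/-- The quotient by the monomial with exponent `α i` and coefficient `c i` of the part of `u`
whose exponents are assigned to `i` by `sel`. -/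
noncomputable def divQuotient [Field k] (sel : (Fin n →₀ ℕ) → Option ι) (α : ι → Fin n →₀ ℕ)
    (c : ι → k) (i : ι) (u : MvPowerSeries (Fin n) k) : MvPowerSeries (Fin n) k :=
  open Classical in
  fun γ => if sel (γ + α i) = some i then (c i)⁻¹ * MvPowerSeries.coeff (γ + α i) u else 0

/-- The part of `u` whose exponents are not assigned to any index by `sel`. -/
noncomputable def divRemainder [Field k] (sel : (Fin n →₀ ℕ) → Option ι)
    (u : MvPowerSeries (Fin n) k) : MvPowerSeries (Fin n) k :=
  open Classical in
  fun γ => if sel γ = none then MvPowerSeries.coeff γ u else 0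

/-- The error made when the quotients of `u` by the monomials with exponents `α i` are multiplied
by power series with leading terms these monomials, `h i` being the series without leading term. -/
noncomputable def divError [Field k] [Fintype ι] (sel : (Fin n →₀ ℕ) → Option ι)
    (α : ι → Fin n →₀ ℕ) (c : ι → k) (h : ι → MvPowerSeries (Fin n) k)
    (u : MvPowerSeries (Fin n) k) : MvPowerSeries (Fin n) k :=
  ∑ i, divQuotient sel α c i u * h i

/-- The successive approximations to the solution `u` of `u + divError u = g`. -/
noncomputable def divApprox [Field k] [Fintype ι] (sel : (Fin n →₀ ℕ) → Option ι)
    (α : ι → Fin n →₀ ℕ) (c : ι → k) (h : ι → MvPowerSeries (Fin n) k)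
    (g : MvPowerSeries (Fin n) k) : ℕ → MvPowerSeries (Fin n) k
  | 0 => 0
  | j + 1 => g - divError sel α c h (divApprox sel α c h g j)

/-- The solution `u` of `u + divError u = g`: the coefficient at `δ` of the approximations is
constant from the index `monomialValue w δ` on. -/
noncomputable def divSolution [Field k] [Fintype ι] (w : Fin n → ℕ)
    (sel : (Fin n →₀ ℕ) → Option ι) (α : ι → Fin n →₀ ℕ) (c : ι → k)
    (h : ι → MvPowerSeries (Fin n) k) (g : MvPowerSeries (Fin n) k) : MvPowerSeries (Fin n) k :=
  fun δ => MvPowerSeries.coeff δ (divApprox sel α c h g (monomialValue w δ))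

section Formal

variable [Field k] {w : Fin n → ℕ} {sel : (Fin n →₀ ℕ) → Option ι} {α : ι → Fin n →₀ ℕ} {c : ι → k}
  {h : ι → MvPowerSeries (Fin n) k} {g : MvPowerSeries (Fin n) k}

open Classical in
theorem coeff_divQuotient (u : MvPowerSeries (Fin n) k) (i : ι) (γ : Fin n →₀ ℕ) :
    MvPowerSeries.coeff γ (divQuotient sel α c i u) =
      if sel (γ + α i) = some i then (c i)⁻¹ * MvPowerSeries.coeff (γ + α i) u else 0 := rfl

open Classical in
theorem coeff_divRemainder (u : MvPowerSeries (Fin n) k) (γ : Fin n →₀ ℕ) :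
    MvPowerSeries.coeff γ (divRemainder sel u) =
      if sel γ = none then MvPowerSeries.coeff γ u else 0 := rfl

theorem coeff_divQuotient_congr {u u' : MvPowerSeries (Fin n) k} {i : ι} {γ : Fin n →₀ ℕ}
    (huu : MvPowerSeries.coeff (γ + α i) u = MvPowerSeries.coeff (γ + α i) u') :
    MvPowerSeries.coeff γ (divQuotient sel α c i u) =
      MvPowerSeries.coeff γ (divQuotient sel α c i u') := by
  rw [coeff_divQuotient, coeff_divQuotient, huu]

/-- The coefficients of `divError u` depend only on the coefficients of `u` of smaller value. -/
theorem coeff_divError_congr [Fintype ι] (hw : ∀ i, 0 < w i)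
    (hh : ∀ i η, MvPowerSeries.coeff η (h i) ≠ 0 → monomialValue w (α i) < monomialValue w η)
    {u u' : MvPowerSeries (Fin n) k} {δ : Fin n →₀ ℕ}
    (huu : ∀ β, monomialValue w β < monomialValue w δ →
      MvPowerSeries.coeff β u = MvPowerSeries.coeff β u') :
    MvPowerSeries.coeff δ (divError sel α c h u) =
      MvPowerSeries.coeff δ (divError sel α c h u') := by
  classical
  have hpos (m) : 0 < monomialValue w m := Finset.prod_pos fun i _ => pow_pos (hw i) _
  rw [divError, divError, map_sum, map_sum]
  refine Finset.sum_congr rfl fun i _ => ?_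
  rw [MvPowerSeries.coeff_mul, MvPowerSeries.coeff_mul]
  refine Finset.sum_congr rfl fun x hx => ?_
  by_cases h0 : MvPowerSeries.coeff x.2 (h i) = 0
  · rw [h0, mul_zero, mul_zero]
  · congr 1
    refine coeff_divQuotient_congr (huu _ ?_)
    rw [← Finset.HasAntidiagonal.mem_antidiagonal.1 hx, monomialValue_add, monomialValue_add]
    exact Nat.mul_lt_mul_of_pos_left (hh i _ h0) (hpos _)

theorem coeff_divApprox_succ [Fintype ι] (hw : ∀ i, 0 < w i)
    (hh : ∀ i η, MvPowerSeries.coeff η (h i) ≠ 0 → monomialValue w (α i) < monomialValue w η)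
    (j : ℕ) : ∀ δ, monomialValue w δ ≤ j →
      MvPowerSeries.coeff δ (divApprox sel α c h g (j + 1)) =
        MvPowerSeries.coeff δ (divApprox sel α c h g j) := by
  have hpos (m) : 0 < monomialValue w m := Finset.prod_pos fun i _ => pow_pos (hw i) _
  induction j with
  | zero => exact fun δ hδ => absurd hδ (hpos δ).not_ge
  | succ j ih =>
    intro δ hδ
    rw [divApprox, divApprox, map_sub, map_sub]
    congr 1
    exact coeff_divError_congr hw hh fun β hβ => ih β (by omega)

theorem coeff_divSolution [Fintype ι] (hw : ∀ i, 0 < w i)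
    (hh : ∀ i η, MvPowerSeries.coeff η (h i) ≠ 0 → monomialValue w (α i) < monomialValue w η)
    {j : ℕ} {δ : Fin n →₀ ℕ} (hj : monomialValue w δ ≤ j) :
    MvPowerSeries.coeff δ (divSolution w sel α c h g) =
      MvPowerSeries.coeff δ (divApprox sel α c h g j) := by
  induction j, hj using Nat.le_induction with
  | base => rfl
  | succ j hj ih => rw [ih, coeff_divApprox_succ hw hh j δ hj]

theorem divSolution_add_divError [Fintype ι] (hw : ∀ i, 0 < w i)
    (hh : ∀ i η, MvPowerSeries.coeff η (h i) ≠ 0 → monomialValue w (α i) < monomialValue w η) :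
    divSolution w sel α c h g + divError sel α c h (divSolution w sel α c h g) = g := by
  ext δ
  have h1 : MvPowerSeries.coeff δ (divError sel α c h (divSolution w sel α c h g)) =
      MvPowerSeries.coeff δ (divError sel α c h (divApprox sel α c h g (monomialValue w δ))) :=
    coeff_divError_congr hw hh fun β hβ => coeff_divSolution hw hh hβ.le
  rw [map_add, h1, coeff_divSolution hw hh (Nat.le_succ _), divApprox, map_sub, sub_add_cancel]

/-- The decomposition of `u` along `sel`. -/
theorem sum_divQuotient_add_divRemainder [Fintype ι] (hsel : ∀ β i, sel β = some i → α i ≤ β)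
    (hc : ∀ i, c i ≠ 0) (u : MvPowerSeries (Fin n) k) :
    ∑ i, divQuotient sel α c i u * MvPowerSeries.monomial (α i) (c i) + divRemainder sel u = u := by
  classical
  ext β
  have h1 (i : ι) : MvPowerSeries.coeff β
      (divQuotient sel α c i u * MvPowerSeries.monomial (α i) (c i)) =
      if sel β = some i then MvPowerSeries.coeff β u else 0 := by
    rw [MvPowerSeries.coeff_mul_monomial]
    by_cases hle : α i ≤ β
    · rw [if_pos hle]
      rw [coeff_divQuotient, tsub_add_cancel_of_le hle]
      split_ifs
      · rw [mul_comm, mul_inv_cancel_left₀ (hc i)]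
      · rw [zero_mul]
    · rw [if_neg hle, if_neg fun hs => hle (hsel β i hs)]
  rw [map_add, map_sum, Finset.sum_congr rfl fun i _ => h1 i, coeff_divRemainder]
  rcases hs : sel β with _ | i
  · simp
  · simp

theorem divQuotient_mem_supportedIn {T : Finset (Fin n)} {u : MvPowerSeries (Fin n) k}
    (hu : u ∈ supportedIn k T) (i : ι) : divQuotient sel α c i u ∈ supportedIn k T := by
  intro m hm
  have h1 : MvPowerSeries.coeff (m + α i) u ≠ 0 := by
    intro h0
    apply hm
    rw [coeff_divQuotient, h0, mul_zero, ite_self]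
  refine Finset.Subset.trans (fun j hj => ?_) (hu _ h1)
  simp only [Finsupp.mem_support_iff, Finsupp.add_apply] at hj ⊢
  omega

theorem divApprox_mem_supportedIn [Fintype ι] {T : Finset (Fin n)} (hg : g ∈ supportedIn k T)
    (hhT : ∀ i, h i ∈ supportedIn k T) (j : ℕ) : divApprox sel α c h g j ∈ supportedIn k T := by
  induction j with
  | zero => exact zero_mem _
  | succ j ih =>
    exact sub_mem hg (sum_mem fun i _ => mul_mem (divQuotient_mem_supportedIn ih i) (hhT i))

theorem divRemainder_mem_supportedIn {T : Finset (Fin n)} {u : MvPowerSeries (Fin n) k}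
    (hu : u ∈ supportedIn k T) : divRemainder sel u ∈ supportedIn k T := by
  intro m hm
  refine hu m fun h0 => hm ?_
  rw [coeff_divRemainder, h0, ite_self]

end Formal

section Norm

variable [NormedField k] {w : Fin n → ℕ} {sel : (Fin n →₀ ℕ) → Option ι} {α : ι → Fin n →₀ ℕ}
  {c : ι → k} {h : ι → MvPowerSeries (Fin n) k} {g : MvPowerSeries (Fin n) k}

theorem polyNorm_divRemainder_le (ρ : Fin n → ℝ≥0∞) (u : MvPowerSeries (Fin n) k) :
    polyNorm ρ (divRemainder sel u) ≤ polyNorm ρ u := by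
  refine ENNReal.tsum_le_tsum fun m => mul_le_mul_left ?_ _
  rw [coeff_divRemainder]
  split_ifs
  · exact le_rfl
  · simp

theorem polyNorm_divQuotient_mul_le (ρ : Fin n → ℝ≥0∞) (u : MvPowerSeries (Fin n) k) (i : ι) :
    polyNorm ρ (divQuotient sel α c i u) * monomialValue ρ (α i) ≤ ‖(c i)⁻¹‖ₑ * polyNorm ρ u := by
  rw [polyNorm, polyNorm, ← ENNReal.tsum_mul_right, ← ENNReal.tsum_mul_left]
  refine le_trans (ENNReal.tsum_le_tsum fun γ => ?_)
    (ENNReal.tsum_comp_le_tsum_of_injective (add_left_injective (α i))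
      fun β => ‖(c i)⁻¹‖ₑ * (‖MvPowerSeries.coeff β u‖ₑ * monomialValue ρ β))
  rw [mul_assoc, ← monomialValue_add, ← mul_assoc, ← enorm_mul]
  refine mul_le_mul_left ?_ _
  rw [coeff_divQuotient]
  split_ifs
  · exact le_rfl
  · simp

theorem polyNorm_divQuotient_le {ρ : Fin n → ℝ≥0∞} (h0 : ∀ i, monomialValue ρ (α i) ≠ 0)
    (h1 : ∀ i, monomialValue ρ (α i) ≠ ⊤) (u : MvPowerSeries (Fin n) k) (i : ι) :
    polyNorm ρ (divQuotient sel α c i u) ≤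
      ‖(c i)⁻¹‖ₑ * (monomialValue ρ (α i))⁻¹ * polyNorm ρ u := by
  have h2 := mul_le_mul_left (polyNorm_divQuotient_mul_le (sel := sel) (α := α) (c := c) ρ u i)
    (monomialValue ρ (α i))⁻¹
  rw [mul_assoc, ENNReal.mul_inv_cancel (h0 i) (h1 i), mul_one] at h2
  exact h2.trans (le_of_eq (by ring))

theorem polyNorm_divError_le [Fintype ι] {ρ : Fin n → ℝ≥0∞} (h0 : ∀ i, monomialValue ρ (α i) ≠ 0)
    (h1 : ∀ i, monomialValue ρ (α i) ≠ ⊤) (u : MvPowerSeries (Fin n) k) :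
    polyNorm ρ (divError sel α c h u) ≤
      (∑ i, ‖(c i)⁻¹‖ₑ * ((monomialValue ρ (α i))⁻¹ * polyNorm ρ (h i))) * polyNorm ρ u := by
  rw [Finset.sum_mul]
  refine (polyNorm_sum_le ρ _ _).trans (Finset.sum_le_sum fun i _ => ?_)
  refine (polyNorm_mul_le ρ _ _).trans ?_
  refine (mul_le_mul_left (polyNorm_divQuotient_le h0 h1 u i) _).trans (le_of_eq (by ring))

/-- If division by the leading monomials is a contraction in norm, the solution is bounded. -/
theorem polyNorm_divSolution_le [Fintype ι] (hw : ∀ i, 0 < w i)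
    (hh : ∀ i η, MvPowerSeries.coeff η (h i) ≠ 0 → monomialValue w (α i) < monomialValue w η)
    {ρ : Fin n → ℝ≥0∞} (hρ : ∀ u : MvPowerSeries (Fin n) k,
      polyNorm ρ (divError sel α c h u) ≤ 2⁻¹ * polyNorm ρ u) :
    polyNorm ρ (divSolution w sel α c h g) ≤ 2 * polyNorm ρ g := by
  have happrox (j : ℕ) : polyNorm ρ (divApprox sel α c h g j) ≤ 2 * polyNorm ρ g := by
    induction j with
    | zero => simp [divApprox]
    | succ j ih =>
      rw [divApprox]
      calc _ ≤ polyNorm ρ g + 2⁻¹ * polyNorm ρ (divApprox sel α c h g j) :=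
            (polyNorm_sub_le ρ _ _).trans (add_le_add_right (hρ _) _)
        _ ≤ polyNorm ρ g + 2⁻¹ * (2 * polyNorm ρ g) := by gcongr
        _ = 2 * polyNorm ρ g := by
          rw [← mul_assoc, ENNReal.inv_mul_cancel two_ne_zero ENNReal.ofNat_ne_top, one_mul,
            two_mul]
  rw [polyNorm, ENNReal.tsum_eq_iSup_sum]
  refine iSup_le fun s => ?_
  have h2 : ∑ m ∈ s, ‖MvPowerSeries.coeff m (divSolution w sel α c h g)‖ₑ * monomialValue ρ m =
      ∑ m ∈ s, ‖MvPowerSeries.coeff m (divApprox sel α c h g (s.sup (monomialValue w)))‖ₑ *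
        monomialValue ρ m :=
    Finset.sum_congr rfl fun m hm => by rw [coeff_divSolution hw hh (Finset.le_sup hm)]
  rw [h2]
  exact (ENNReal.sum_le_tsum s).trans (happrox _)

/-- On small polydiscs the tail of a convergent power series is dominated by its leading
monomial. -/
theorem tendsto_polyNorm_tail {p : MvPowerSeries (Fin n) k} (hp : IsConvergent p)
    (hw : ∀ i, 1 < w i) {a : Fin n →₀ ℕ}
    (ha : ∀ η, MvPowerSeries.coeff η p ≠ 0 → monomialValue w a < monomialValue w η) :
    Filter.Tendsto (fun s => (monomialValue (weightRadius w s) a)⁻¹ *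
      polyNorm (weightRadius w s) p) Filter.atTop (nhds 0) := by
  obtain ⟨s₀, hs₀⟩ := (hp.eventually_polyNorm_ne_top hw).exists
  have hpos (m) : 0 < monomialValue w m :=
    Finset.prod_pos fun i _ => pow_pos (zero_lt_one.trans (hw i)) _
  set N : ℝ≥0∞ := ((monomialValue w a : ℕ) : ℝ≥0∞) with hN
  have hN0 : N ≠ 0 := by
    rw [hN]
    exact_mod_cast (hpos a).ne'
  have hNt : N ≠ ⊤ := ENNReal.natCast_ne_top _
  have hval (s : ℕ) : (monomialValue (weightRadius w s) a)⁻¹ = N ^ s := by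
    rw [monomialValue_weightRadius, ENNReal.inv_pow, inv_inv]
  set θ : ℝ≥0∞ := N * (N + 1)⁻¹ with hθ
  -- every exponent of `p` has value at least `N + 1`
  have hθ1 : θ < 1 := by
    rw [hθ, ← div_eq_mul_inv]
    refine ENNReal.div_lt_of_lt_mul' ?_
    rw [mul_one]
    exact ENNReal.lt_add_right hNt one_ne_zero
  rw [← Filter.tendsto_add_atTop_iff_nat s₀]
  have hle (t : ℕ) : (monomialValue (weightRadius w (t + s₀)) a)⁻¹ *
      polyNorm (weightRadius w (t + s₀)) p ≤
      θ ^ t * (N ^ s₀ * polyNorm (weightRadius w s₀) p) := by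
    rw [hval, polyNorm, polyNorm, ← ENNReal.tsum_mul_left, ← ENNReal.tsum_mul_left,
      ← ENNReal.tsum_mul_left]
    refine ENNReal.tsum_le_tsum fun η => ?_
    by_cases h0 : MvPowerSeries.coeff η p = 0
    · simp [h0]
    · have h1 : ((monomialValue w η : ℕ) : ℝ≥0∞)⁻¹ ≤ (N + 1)⁻¹ := by
        refine ENNReal.inv_le_inv.2 ?_
        rw [hN]
        exact_mod_cast ha η h0
      rw [monomialValue_weightRadius, monomialValue_weightRadius, pow_add, pow_add, hθ, mul_pow]
      calc _ = N ^ t * (((monomialValue w η : ℕ) : ℝ≥0∞)⁻¹ ^ t) * (N ^ s₀ *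
            (‖MvPowerSeries.coeff η p‖ₑ * ((monomialValue w η : ℕ) : ℝ≥0∞)⁻¹ ^ s₀)) := by ring
        _ ≤ _ := by gcongr
  refine tendsto_of_tendsto_of_tendsto_of_le_of_le tendsto_const_nhds ?_ (fun _ => zero_le) hle
  have h2 := ENNReal.Tendsto.mul_const (b := N ^ s₀ * polyNorm (weightRadius w s₀) p)
    (ENNReal.tendsto_pow_atTop_nhds_zero_of_lt_one hθ1)
    (Or.inr (ENNReal.mul_ne_top (ENNReal.pow_ne_top hNt) hs₀))
  rwa [zero_mul] at h2

/-- **Division theorem** of Hironaka and Grauert. A convergent power series can be divided by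
finitely many others so that no exponent of the remainder is divisible by a leading exponent of
a divisor; quotients and remainder involve the same variables `T` as the data. The coefficients of
the solution are determined recursively along the monomial order, and on a small polydisc the
recursion is a contraction. -/
theorem exists_division [Fintype ι] {T : Finset (Fin n)} (hw : ∀ i, 1 < w i)
    (F : ι → convergentIn k T) (hα : ∀ i, IsLeadingExponent w (F i : MvPowerSeries (Fin n) k) (α i))
    (g : convergentIn k T) :
    ∃ (q : ι → convergentIn k T) (r : convergentIn k T), g = ∑ i, q i * F i + r ∧
      ∀ m, MvPowerSeries.coeff m (r : MvPowerSeries (Fin n) k) ≠ 0 → ∀ i, ¬ α i ≤ m := by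
  classical
  let c : ι → k := fun i => MvPowerSeries.coeff (α i) (F i : MvPowerSeries (Fin n) k)
  have hc (i : ι) : c i ≠ 0 := (hα i).1
  let lt : ι → MvPowerSeries (Fin n) k := fun i => MvPowerSeries.monomial (α i) (c i)
  let h : ι → MvPowerSeries (Fin n) k := fun i => F i - lt i
  let sel : (Fin n →₀ ℕ) → Option ι := fun β =>
    if hβ : ∃ i, α i ≤ β then some hβ.choose else none
  have hsel : ∀ β i, sel β = some i → α i ≤ β := by
    intro β i hi
    by_cases hβ : ∃ i, α i ≤ β
    · simp only [sel, dif_pos hβ, Option.some.injEq] at hi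
      exact hi ▸ hβ.choose_spec
    · simp [sel, dif_neg hβ] at hi
  have hw0 (i) : 0 < w i := zero_lt_one.trans (hw i)
  have hh : ∀ i η, MvPowerSeries.coeff η (h i) ≠ 0 → monomialValue w (α i) < monomialValue w η := by
    intro i η hη
    have hne : η ≠ α i := by
      rintro rfl
      apply hη
      simp only [h, lt, map_sub, MvPowerSeries.coeff_monomial_same, c, sub_self]
    refine (hα i).2 η ?_ hne
    simpa [h, lt, MvPowerSeries.coeff_monomial_ne hne] using hη
  have hltconv (i) : IsConvergent (lt i) := by
    refine isConvergent_iff_polyNorm.2 ⟨fun _ => 1, fun _ => one_ne_zero, ?_⟩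
    rw [polyNorm_monomial, monomialValue_const, one_pow, mul_one]
    exact enorm_ne_top
  have hltT (i) : lt i ∈ supportedIn k T := by
    intro m hm
    have : m = α i := by
      by_contra hne
      exact hm (MvPowerSeries.coeff_monomial_ne hne _)
    rw [this]
    exact (F i).2.2 _ (hα i).1
  have hhconv (i) : IsConvergent (h i) :=
    (convergentPowerSeries k n).sub_mem (F i).2.1 (hltconv i)
  have hhT (i) : h i ∈ supportedIn k T := sub_mem (F i).2.2 (hltT i)
  -- a radius for which division by the leading monomials is a contraction
  have hlim : Filter.Tendsto (fun s => ∑ i, ‖(c i)⁻¹‖ₑ *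
      ((monomialValue (weightRadius w s) (α i))⁻¹ * polyNorm (weightRadius w s) (h i)))
      Filter.atTop (nhds 0) := by
    have h1 (i : ι) := ENNReal.Tendsto.const_mul (a := ‖(c i)⁻¹‖ₑ)
      (tendsto_polyNorm_tail (hhconv i) hw (hh i)) (Or.inr enorm_ne_top)
    have h2 := tendsto_finsetSum Finset.univ fun i _ => h1 i
    simpa using h2
  obtain ⟨s, hs, hgs⟩ := ((hlim.eventually_le_const (u := 2⁻¹) (by simp)).and
    (IsConvergent.eventually_polyNorm_ne_top g.2.1 hw)).exists
  have hm0 (i) : monomialValue (weightRadius w s) (α i) ≠ 0 := by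
    rw [monomialValue_weightRadius]
    exact pow_ne_zero _ (ENNReal.inv_ne_zero.2 (ENNReal.natCast_ne_top _))
  have hm1 (i) : monomialValue (weightRadius w s) (α i) ≠ ⊤ := by
    rw [monomialValue_weightRadius]
    refine ENNReal.pow_ne_top (ENNReal.inv_ne_top.2 ?_)
    exact_mod_cast (Finset.prod_pos fun i _ => pow_pos (hw0 i) _).ne'
  set u := divSolution w sel α c h (g : MvPowerSeries (Fin n) k) with hu
  have hunorm : polyNorm (weightRadius w s) u ≠ ⊤ := by
    refine ne_top_of_le_ne_top (ENNReal.mul_ne_top ENNReal.ofNat_ne_top hgs)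
      (polyNorm_divSolution_le hw0 hh fun v => (polyNorm_divError_le hm0 hm1 v).trans ?_)
    gcongr
  have huT : u ∈ supportedIn k T := fun m hm => by
    rw [hu, coeff_divSolution hw0 hh le_rfl] at hm
    exact divApprox_mem_supportedIn g.2.2 hhT _ m hm
  refine ⟨fun i => ⟨divQuotient sel α c i u, isConvergent_of_polyNorm_weightRadius (w := w) (s := s)
      (ne_top_of_le_ne_top (ENNReal.mul_ne_top (ENNReal.mul_ne_top enorm_ne_top
        (ENNReal.inv_ne_top.2 (hm0 i))) hunorm) (polyNorm_divQuotient_le hm0 hm1 u i)),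
      divQuotient_mem_supportedIn huT i⟩,
    ⟨divRemainder sel u, isConvergent_of_polyNorm_weightRadius (w := w) (s := s)
      (ne_top_of_le_ne_top hunorm (polyNorm_divRemainder_le _ u)),
      divRemainder_mem_supportedIn huT⟩, ?_, fun m hm i hi => ?_⟩
  · apply Subtype.ext
    have h1 := divSolution_add_divError (sel := sel) (c := c) (g := (g : MvPowerSeries (Fin n) k))
      hw0 hh
    have h2 := sum_divQuotient_add_divRemainder hsel hc u
    rw [← hu] at h1
    push_cast
    nth_rewrite 1 [← h1]
    nth_rewrite 1 [← h2]
    rw [divError, add_right_comm, ← Finset.sum_add_distrib]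
    congr 1
    refine Finset.sum_congr rfl fun i _ => ?_
    rw [← mul_add]
    simp only [h, lt, add_sub_cancel]
  · apply hm
    rw [coeff_divRemainder, if_neg]
    simp only [sel]
    rw [dif_pos ⟨i, hi⟩]
    exact Option.some_ne_none _

end Norm

end Division

/-! ### Convergent power series form a Noetherian normal domain -/

section ConvergentIn

variable {k : Type u} [NormedField k] {n : ℕ}

/-- Distinct primes to serve as weights of the variables. -/
theorem exists_prime_weights (n : ℕ) :
    ∃ w : Fin n → ℕ, (∀ i, (w i).Prime) ∧ Function.Injective w :=
  ⟨fun i => Nat.nth Nat.Prime i, fun i => Nat.prime_nth_prime i, fun _ _ hij =>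
    Fin.ext ((Nat.nth_strictMono Nat.infinite_setOfPred_prime).injective hij)⟩

variable (k) in
/-- Every ideal is generated by elements with the minimal leading exponents: on division by them the
remainder of an element of the ideal has no leading exponent and thus vanishes. -/
instance isNoetherianRing_convergentIn (T : Finset (Fin n)) :
    IsNoetherianRing (convergentIn k T) := by
  classical
  obtain ⟨w, hw, hinj⟩ := exists_prime_weights n
  have hN := monomialValue_injective hw hinj
  refine (isNoetherianRing_iff_ideal_fg _).2 fun I => ?_
  let L : Set (Fin n →₀ ℕ) := {a | ∃ p ∈ I, IsLeadingExponent w (p : MvPowerSeries (Fin n) k) a}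
  -- Dickson's lemma: the minimal leading exponents of `I` are finite in number
  have hfin : {a | Minimal (· ∈ L) a}.Finite :=
    (setOfPred_minimal_antichain _).finite_of_partiallyWellOrderedOn
      (Set.isPWO_of_wellQuasiOrderedLE _)
  have hfin' := hfin.to_subtype
  have := Fintype.ofFinite {a | Minimal (· ∈ L) a}
  choose F hFI hF using fun a : {a | Minimal (· ∈ L) a} => a.2.1
  refine ⟨Finset.univ.image F, le_antisymm (Submodule.span_le.2 ?_) fun g hg => ?_⟩
  · intro p hp
    obtain ⟨a, -, rfl⟩ := Finset.mem_image.1 (Finset.mem_coe.1 hp)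
    exact hFI a
  · obtain ⟨q, r, hgr, hr⟩ := exists_division (fun i => (hw i).one_lt) F hF g
    have hsum : ∑ i, q i * F i ∈ Ideal.span ((Finset.univ.image F : Finset _) : Set _) :=
      sum_mem fun i _ => Ideal.mul_mem_left _ _ (Ideal.subset_span (by simp))
    have hr0 : r = 0 := by
      by_contra hr0
      have hrI : r ∈ I := by
        rw [← sub_eq_of_eq_add' hgr]
        exact I.sub_mem hg (sum_mem fun i _ => I.mul_mem_left _ (hFI i))
      obtain ⟨b, hb⟩ := exists_isLeadingExponent hN (p := (r : MvPowerSeries (Fin n) k))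
        (fun h => hr0 (Subtype.ext h))
      obtain ⟨a, hab, ha⟩ : ∃ a ≤ b, Minimal (· ∈ L) a :=
        exists_minimal_le_of_wellFoundedLT (· ∈ L) b ⟨r, hrI, hb⟩
      exact hr b hb.1 ⟨a, ha⟩ hab
    rw [hgr, hr0, add_zero]
    exact hsum

/-- If `h / g` is integral, hence almost integral, let `r` be the remainder of `h` on division by
`g`. There is `c ≠ 0` such that `g ^ m` divides `c r ^ m` for all `m`; comparison of leading
exponents for `m → ∞` shows that the leading exponent of `g` divides that of `r`, so `r = 0`. -/
instance isIntegrallyClosed_convergentIn (T : Finset (Fin n)) :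
    IsIntegrallyClosed (convergentIn k T) := by
  obtain ⟨w, hw, hinj⟩ := exists_prime_weights n
  have hw0 (i) : 0 < w i := (hw i).pos
  have hN := monomialValue_injective hw hinj
  have hne {p : convergentIn k T} (hp : p ≠ 0) : (p : MvPowerSeries (Fin n) k) ≠ 0 :=
    fun h => hp (Subtype.ext h)
  let K := FractionRing (convergentIn k T)
  refine (isIntegrallyClosed_iff K).2 fun {x} hx => ?_
  obtain ⟨h, g, hg, rfl⟩ := IsFractionRing.div_surjective (A := convergentIn k T) x
  have hg0 := nonZeroDivisors.ne_zero hg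
  have hgK : algebraMap (convergentIn k T) K g ≠ 0 := fun h0 => hg0
    ((FaithfulSMul.algebraMap_eq_zero_iff _ _).1 h0)
  obtain ⟨a, ha⟩ := exists_isLeadingExponent hN (hne hg0)
  obtain ⟨q, r, hgr, hr⟩ := exists_division (ι := Unit) (fun i => (hw i).one_lt) (fun _ => g)
    (α := fun _ => a) (fun _ => ha) h
  rw [Fintype.sum_unique] at hgr
  set q := q default
  suffices hr0 : r = 0 by
    refine ⟨q, ?_⟩
    rw [hgr, hr0, add_zero, map_mul, mul_div_cancel_right₀ _ hgK]
  by_contra hr0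
  have hxr : IsIntegral (convergentIn k T)
      (algebraMap (convergentIn k T) K r / algebraMap _ K g) := by
    have h1 : algebraMap (convergentIn k T) K r / algebraMap _ K g =
        algebraMap _ K h / algebraMap _ K g - algebraMap _ K q := by
      rw [hgr, map_add, map_mul, add_div, mul_div_cancel_right₀ _ hgK, add_sub_cancel_left]
    rw [h1]
    exact hx.sub isIntegral_algebraMap
  obtain ⟨c, hc, hcm⟩ := hxr.isAlmostIntegral
  have hc0 := nonZeroDivisors.ne_zero hc
  obtain ⟨b, hb⟩ := exists_isLeadingExponent hN (hne hr0)
  obtain ⟨γ, hγ⟩ := exists_isLeadingExponent hN (hne hc0)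
  refine hr b hb.1 () fun i => ?_
  by_contra hlt
  -- if `b i < a i`, then the exponent `m = γ i + 1` already contradicts `γ + m b = ε + m a`
  obtain ⟨e, he⟩ := hcm (γ i + 1)
  set m := γ i + 1 with hm
  have h2 : c * r ^ m = e * g ^ m := by
    apply IsFractionRing.injective (convergentIn k T) K
    rw [Algebra.smul_def, div_pow] at he
    rw [map_mul, map_pow, map_mul, map_pow, he, mul_assoc,
      div_mul_cancel₀ _ (pow_ne_zero m hgK)]
  have h3 : (c : MvPowerSeries (Fin n) k) * (r : MvPowerSeries (Fin n) k) ^ m =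
      (e : MvPowerSeries (Fin n) k) * (g : MvPowerSeries (Fin n) k) ^ m := by
    have := congrArg Subtype.val h2
    simpa using this
  have he0 : e ≠ 0 := by
    rintro rfl
    rw [zero_mul] at h2
    exact mul_ne_zero hc0 (pow_ne_zero m hr0) h2
  obtain ⟨ε, hε⟩ := exists_isLeadingExponent hN (hne he0)
  have h4 := (hγ.mul hw0 (hb.pow hw0 m)).unique (h3 ▸ hε.mul hw0 (ha.pow hw0 m))
  have h5 := DFunLike.congr_fun h4 i
  simp only [Finsupp.add_apply, Finsupp.smul_apply, smul_eq_mul] at h5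
  have h6 : b i + 1 ≤ a i := not_le.1 hlt
  have h7 : m * (b i + 1) ≤ m * a i := Nat.mul_le_mul_left m h6
  rw [mul_add, mul_one] at h7
  omega

end ConvergentIn

/-! ### Weierstrass division -/

section Weierstrass

variable {k : Type u} [NormedField k] {n : ℕ} {T : Finset (Fin n)}

theorem supportedIn_mono {S T : Finset (Fin n)} (h : S ⊆ T) :
    supportedIn k S ≤ supportedIn k T := fun _ hp m hm => (hp m hm).trans h

theorem convergentIn_mono {S T : Finset (Fin n)} (h : S ⊆ T) :
    convergentIn k S ≤ convergentIn k T := inf_le_inf_left _ (supportedIn_mono h)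

theorem X_mem_convergentIn {t : Fin n} (ht : t ∈ T) :
    (MvPowerSeries.X t : MvPowerSeries (Fin n) k) ∈ convergentIn k T := by
  classical
  constructor
  · refine isConvergent_iff_polyNorm.2 ⟨fun _ => 1, fun _ => one_ne_zero, ?_⟩
    rw [polyNorm_X]
    exact ENNReal.one_ne_top
  · intro m hm
    rw [MvPowerSeries.coeff_X] at hm
    have : m = Finsupp.single t 1 := by
      by_contra h
      exact hm (if_neg h)
    rw [this]
    exact Finsupp.support_single_subset.trans (by simpa using ht)

/-- The coefficient of `x_t ^ e` of a power series, a power series in the other variables. -/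
noncomputable def variableCoeff (t : Fin n) (e : ℕ) (p : MvPowerSeries (Fin n) k) :
    MvPowerSeries (Fin n) k :=
  fun m => if m t = 0 then MvPowerSeries.coeff (m + Finsupp.single t e) p else 0

theorem coeff_variableCoeff (t : Fin n) (e : ℕ) (p : MvPowerSeries (Fin n) k) (m : Fin n →₀ ℕ) :
    MvPowerSeries.coeff m (variableCoeff t e p) =
      if m t = 0 then MvPowerSeries.coeff (m + Finsupp.single t e) p else 0 := rfl

theorem variableCoeff_mem {p : MvPowerSeries (Fin n) k} (hp : p ∈ convergentIn k T) (t : Fin n)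
    (e : ℕ) : variableCoeff t e p ∈ convergentIn k (T.erase t) := by
  constructor
  · obtain ⟨ρ, hρ, hpρ⟩ := isConvergent_iff_polyNorm.1 hp.1
    refine isConvergent_iff_polyNorm.2 ⟨ρ, hρ, fun htop => ?_⟩
    have hle : polyNorm ρ (variableCoeff t e p) * ρ t ^ e ≤ polyNorm ρ p := by
      rw [polyNorm, polyNorm, ← ENNReal.tsum_mul_right]
      refine le_trans (ENNReal.tsum_le_tsum fun γ => ?_)
        (ENNReal.tsum_comp_le_tsum_of_injective (add_left_injective (Finsupp.single t e))
          fun β => ‖MvPowerSeries.coeff β p‖ₑ * monomialValue ρ β)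
      rw [monomialValue_add, monomialValue_single, mul_assoc, coeff_variableCoeff]
      refine mul_le_mul_left ?_ _
      split_ifs
      · exact le_rfl
      · simp
    rw [htop, ENNReal.top_mul (pow_ne_zero e (hρ t))] at hle
    exact hpρ (top_le_iff.1 hle)
  · intro m hm j hj
    rw [coeff_variableCoeff] at hm
    have hmt : m t = 0 := by
      by_contra h
      exact hm (if_neg h)
    rw [if_pos hmt] at hm
    refine Finset.mem_erase.2 ⟨?_, hp.2 _ hm ?_⟩
    · rintro rfl
      exact (Finsupp.mem_support_iff.1 hj) hmt
    · simp only [Finsupp.mem_support_iff, Finsupp.add_apply] at hj ⊢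
      omega

theorem eq_sum_variableCoeff {t : Fin n} {d : ℕ} {p : MvPowerSeries (Fin n) k}
    (hp : ∀ m, MvPowerSeries.coeff m p ≠ 0 → m t < d) :
    p = ∑ e ∈ Finset.range d, variableCoeff t e p * MvPowerSeries.X t ^ e := by
  classical
  ext m
  have h1 (e : ℕ) : MvPowerSeries.coeff m (variableCoeff t e p * MvPowerSeries.X t ^ e) =
      if e = m t then MvPowerSeries.coeff m p else 0 := by
    rw [MvPowerSeries.X_pow_eq, MvPowerSeries.coeff_mul_monomial, mul_one, coeff_variableCoeff]
    by_cases hle : Finsupp.single t e ≤ m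
    · have hle' : e ≤ m t := by simpa using hle t
      rw [if_pos hle, tsub_add_cancel_of_le hle]
      refine if_congr ?_ rfl rfl
      simp only [Finsupp.tsub_apply, Finsupp.single_eq_same]
      omega
    · rw [if_neg hle, if_neg]
      rintro rfl
      exact hle (Finsupp.single_le_iff.2 le_rfl)
  rw [map_sum, Finset.sum_congr rfl fun e _ => h1 e, Finset.sum_ite_eq']
  split_ifs with h
  · rfl
  · by_contra h0
    exact h (Finset.mem_range.2 (hp m h0))

/-- Weierstrass division by a power series regular in `x_t`: this is the division theorem for
weights for which the leading exponent is a power of `x_t`. -/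
theorem exists_weierstrass_division {t : Fin n} (f : convergentIn k T) {e : ℕ}
    (hf : MvPowerSeries.coeff (Finsupp.single t e) (f : MvPowerSeries (Fin n) k) ≠ 0) :
    ∃ d, ∀ g : convergentIn k T, ∃ (q r : convergentIn k T), g = q * f + r ∧
      ∀ m, MvPowerSeries.coeff m (r : MvPowerSeries (Fin n) k) ≠ 0 → m t < d := by
  classical
  have hex : ∃ e, MvPowerSeries.coeff (Finsupp.single t e) (f : MvPowerSeries (Fin n) k) ≠ 0 :=
    ⟨e, hf⟩
  let d := Nat.find hex
  -- the weight of `x_t` is `2`, and those of the other variables exceed `2 ^ d`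
  let w : Fin n → ℕ := fun j => Nat.nth Nat.Prime (if j = t then 0 else 2 ^ d + j)
  have hw (j) : (w j).Prime := Nat.prime_nth_prime _
  have hwt : w t = 2 := by simp [w]
  have hwj {j} (hj : j ≠ t) : 2 ^ d < w j := by
    have h1 : 2 ^ d + (j : ℕ) + 2 ≤ w j := by
      simp only [w, if_neg hj]
      exact Nat.add_two_le_nth_prime _
    omega
  have hlead : IsLeadingExponent w (f : MvPowerSeries (Fin n) k) (Finsupp.single t d) := by
    refine ⟨Nat.find_spec hex, fun b hb hne => ?_⟩
    rw [monomialValue_single, hwt]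
    have hle (j) : w j ^ b j ≤ monomialValue w b :=
      Nat.le_of_dvd (Finset.prod_pos fun i _ => pow_pos (hw i).pos _)
        (Finset.dvd_prod_of_mem (fun i => w i ^ b i) (Finset.mem_univ j))
    by_cases hbj : ∃ j, j ≠ t ∧ b j ≠ 0
    · obtain ⟨j, hj, hbj⟩ := hbj
      exact (hwj hj).trans_le ((Nat.le_self_pow hbj _).trans (hle j))
    · have hbt : b = Finsupp.single t (b t) := by
        ext j
        rcases eq_or_ne j t with rfl | hj
        · simp
        · rw [Finsupp.single_eq_of_ne hj]
          by_contra h0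
          exact hbj ⟨j, hj, h0⟩
      have h1 : d ≤ b t := Nat.find_min' hex (by rwa [← hbt])
      have h2 : d ≠ b t := fun h => hne (by rw [hbt, ← h])
      have h3 := hle t
      rw [hwt] at h3
      exact (Nat.pow_lt_pow_right one_lt_two (lt_of_le_of_ne h1 h2)).trans_le h3
  refine ⟨d, fun g => ?_⟩
  obtain ⟨q, r, hgr, hr⟩ := exists_division (ι := Unit) (fun i => (hw i).one_lt) (fun _ => f)
    (α := fun _ => Finsupp.single t d) (fun _ => hlead) g
  refine ⟨q default, r, by simpa using hgr, fun m hm => ?_⟩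
  have := hr m hm ()
  rw [Finsupp.single_le_iff] at this
  omega

end Weierstrass

/-! ### Linear changes of coordinates -/

section Shear

variable {k : Type u} {n : ℕ}

theorem hasSubst_shear [Field k] (t : Fin n) (c : Fin n → k) :
    MvPowerSeries.HasSubst fun j : Fin n =>
      (MvPowerSeries.X j + MvPowerSeries.C (c j) * MvPowerSeries.X t : MvPowerSeries (Fin n) k) :=
  MvPowerSeries.hasSubst_of_constantCoeff_zero fun j => by simp

/-- The substitution `x_j ↦ x_j + c_j x_t`. -/
noncomputable def shear [Field k] (t : Fin n) (c : Fin n → k) :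
    MvPowerSeries (Fin n) k →ₐ[k] MvPowerSeries (Fin n) k :=
  MvPowerSeries.substAlgHom (hasSubst_shear t c)

theorem shear_neg_shear [Field k] {t : Fin n} {c : Fin n → k} (hc : c t = 0)
    (p : MvPowerSeries (Fin n) k) : shear t (-c) (shear t c p) = p := by
  have h1 : (fun j => shear t (-c)
      (MvPowerSeries.X j + MvPowerSeries.C (c j) * MvPowerSeries.X t)) = MvPowerSeries.X := by
    funext j
    have hX (i) : shear t (-c) (MvPowerSeries.X i) =
        MvPowerSeries.X i + MvPowerSeries.C (-c i) * MvPowerSeries.X t := by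
      rw [shear, MvPowerSeries.substAlgHom_X]
      rfl
    have hC : shear t (-c) (MvPowerSeries.C (c j)) = MvPowerSeries.C (c j) :=
      (shear t (-c)).commutes (c j)
    rw [map_add, map_mul, hX, hX, hC, hc, map_neg]
    simp
  have h2 := MvPowerSeries.substAlgHom_comp_substAlgHom_apply (R := k) (hasSubst_shear t c)
    (hasSubst_shear t (-c)) p
  rw [shear, shear, h2, MvPowerSeries.coe_substAlgHom]
  change MvPowerSeries.subst (fun j => shear t (-c)
      (MvPowerSeries.X j + MvPowerSeries.C (c j) * MvPowerSeries.X t)) p = p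
  rw [h1, MvPowerSeries.subst_self, id]

theorem shear_shear_neg [Field k] {t : Fin n} {c : Fin n → k} (hc : c t = 0)
    (p : MvPowerSeries (Fin n) k) : shear t c (shear t (-c) p) = p := by
  have := shear_neg_shear (c := -c) (by simpa using hc) p
  rwa [neg_neg] at this

theorem coeff_shear_finite [Field k] (t : Fin n) (c : Fin n → k) (p : MvPowerSeries (Fin n) k)
    (m : Fin n →₀ ℕ) : (Function.support fun d : Fin n →₀ ℕ => MvPowerSeries.coeff d p *
      MvPowerSeries.coeff m (∏ j, (MvPowerSeries.X j + MvPowerSeries.C (c j) * MvPowerSeries.X t :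
          MvPowerSeries (Fin n) k) ^ d j)).Finite := by
  have h := MvPowerSeries.coeff_subst_finite (hasSubst_shear t c) p m
  refine Set.Finite.subset h fun d hd => ?_
  rwa [Function.mem_support, smul_eq_mul, Finsupp.prod_fintype _ _ fun j => pow_zero _]

theorem coeff_shear [Field k] (t : Fin n) (c : Fin n → k) (p : MvPowerSeries (Fin n) k)
    (m : Fin n →₀ ℕ) : MvPowerSeries.coeff m (shear t c p) =
      ∑ᶠ d : Fin n →₀ ℕ, MvPowerSeries.coeff d p * MvPowerSeries.coeff m (∏ j,
        (MvPowerSeries.X j + MvPowerSeries.C (c j) * MvPowerSeries.X t :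
          MvPowerSeries (Fin n) k) ^ d j) := by
  rw [shear, MvPowerSeries.substAlgHom_apply, MvPowerSeries.coeff_subst (hasSubst_shear t c)]
  refine finsum_congr fun d => ?_
  rw [smul_eq_mul, Finsupp.prod_fintype _ _ fun j => pow_zero _]

/-- Linear changes of coordinates preserve convergence, at the cost of a smaller polydisc. -/
theorem shear_mem_convergentIn [NormedField k] {T : Finset (Fin n)} {t : Fin n} (ht : t ∈ T)
    (c : Fin n → k) {p : MvPowerSeries (Fin n) k} (hp : p ∈ convergentIn k T) :
    shear t c p ∈ convergentIn k T := by
  constructor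
  · obtain ⟨r, hr, hsum⟩ := hp.1
    set R := ENNReal.ofReal r with hR
    have hR0 : R ≠ 0 := (ENNReal.ofReal_pos.2 hr).ne'
    have hpR : ∑' d, ‖MvPowerSeries.coeff d p‖ₑ * R ^ d.degree ≠ ⊤ := by
      convert hsum.tsum_ofReal_ne_top using 1
      refine tsum_congr fun m => ?_
      rw [ENNReal.ofReal_mul (norm_nonneg _), ENNReal.ofReal_pow hr.le, ofReal_norm]
    -- on the polydisc of radius `R / B` all the series `x_j + c_j x_t` have norm at most `R`
    set B : ℝ≥0∞ := 1 + ∑ j, ‖c j‖ₑ with hB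
    have hBt : B ≠ ⊤ := ENNReal.add_ne_top.2
      ⟨ENNReal.one_ne_top, ENNReal.sum_ne_top.2 fun j _ => enorm_ne_top⟩
    have hB0 : B ≠ 0 := by simp [hB]
    let ρ : Fin n → ℝ≥0∞ := fun _ => R / B
    have hlin (j : Fin n) : polyNorm ρ (MvPowerSeries.X j + MvPowerSeries.C (c j) *
        MvPowerSeries.X t : MvPowerSeries (Fin n) k) ≤ R := by
      calc _ ≤ R / B + ‖c j‖ₑ * (R / B) := by
            refine (polyNorm_add_le ρ _ _).trans (add_le_add (polyNorm_X ρ j).le ?_)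
            refine (polyNorm_mul_le ρ _ _).trans ?_
            rw [polyNorm_C, polyNorm_X]
        _ = (1 + ‖c j‖ₑ) * (R / B) := by ring
        _ ≤ B * (R / B) := by
            rw [hB]
            gcongr
            exact Finset.single_le_sum (f := fun j => ‖c j‖ₑ) (fun _ _ => zero_le)
              (Finset.mem_univ j)
        _ = R := ENNReal.mul_div_cancel hB0 hBt
    refine isConvergent_iff_polyNorm.2 ⟨ρ, fun _ => ENNReal.div_ne_zero.2 ⟨hR0, hBt⟩,
      ne_top_of_le_ne_top hpR ?_⟩
    let a (d : Fin n →₀ ℕ) : MvPowerSeries (Fin n) k :=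
      ∏ j, (MvPowerSeries.X j + MvPowerSeries.C (c j) * MvPowerSeries.X t) ^ d j
    have ha (d : Fin n →₀ ℕ) : polyNorm ρ (a d) ≤ R ^ d.degree := by
      refine (polyNorm_prod_le ρ _ _).trans ?_
      rw [Finsupp.degree_eq_sum, ← Finset.prod_pow_eq_pow_sum]
      exact Finset.prod_le_prod' fun j _ =>
        (polyNorm_pow_le ρ _ _).trans (pow_le_pow_left' (hlin j) _)
    calc polyNorm ρ (shear t c p)
        ≤ ∑' m, ∑' d, ‖MvPowerSeries.coeff d p‖ₑ * (‖MvPowerSeries.coeff m (a d)‖ₑ *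
            monomialValue ρ m) := by
          refine ENNReal.tsum_le_tsum fun m => ?_
          rw [coeff_shear, finsum_eq_sum _ (coeff_shear_finite t c p m)]
          refine (mul_le_mul_left (enorm_sum_le _ _) _).trans ?_
          rw [Finset.sum_mul]
          refine le_trans (Finset.sum_le_sum fun d _ => ?_) (ENNReal.sum_le_tsum _)
          rw [enorm_mul, mul_assoc]
      _ = ∑' d, ‖MvPowerSeries.coeff d p‖ₑ * polyNorm ρ (a d) := by
          rw [ENNReal.tsum_comm]
          exact tsum_congr fun d => by rw [ENNReal.tsum_mul_left, polyNorm]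
      _ ≤ _ := ENNReal.tsum_le_tsum fun d => mul_le_mul_right (ha d) _
  · intro m hm
    rw [coeff_shear] at hm
    obtain ⟨d, hd⟩ := not_forall.1 fun h => hm (finsum_eq_zero_of_forall_eq_zero h)
    have hdT := hp.2 d (left_ne_zero_of_mul hd)
    have hprod : (∏ j, (MvPowerSeries.X j + MvPowerSeries.C (c j) * MvPowerSeries.X t :
        MvPowerSeries (Fin n) k) ^ d j) ∈ supportedIn k T := by
      refine prod_mem fun j _ => ?_
      by_cases hj : j ∈ T
      · exact pow_mem (add_mem (X_mem_convergentIn hj).2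
          (mul_mem ((supportedIn k T).algebraMap_mem (c j)) (X_mem_convergentIn ht).2)) _
      · have : d j = 0 := by
          by_contra h
          exact hj (hdT (Finsupp.mem_support_iff.2 h))
        rw [this, pow_zero]
        exact one_mem _
    exact hprod m (right_ne_zero_of_mul hd)

/-- The restriction of a power series to the `x_t`-axis. -/
noncomputable def toAxis [Field k] (t : Fin n) : MvPowerSeries (Fin n) k →+* PowerSeries k where
  toFun p := PowerSeries.mk fun e => MvPowerSeries.coeff (Finsupp.single t e) p
  map_one' := by
    classical
    ext e
    rw [PowerSeries.coeff_mk, MvPowerSeries.coeff_one, PowerSeries.coeff_one]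
    simp
  map_zero' := by
    ext e
    simp
  map_add' p q := by
    ext e
    simp
  map_mul' p q := by
    classical
    ext e
    rw [PowerSeries.coeff_mk, MvPowerSeries.coeff_mul, PowerSeries.coeff_mul,
      Finsupp.antidiagonal_single, Finset.sum_map]
    simp

theorem toAxis_X [Field k] (t j : Fin n) :
    toAxis t (MvPowerSeries.X j : MvPowerSeries (Fin n) k) =
      if j = t then PowerSeries.X else 0 := by
  classical
  ext e
  rw [toAxis, RingHom.coe_mk, MonoidHom.coe_mk, OneHom.coe_mk, PowerSeries.coeff_mk,
    MvPowerSeries.coeff_X]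
  split_ifs with h1 h2 h2
  · subst h2
    have : e = 1 := by simpa using DFunLike.congr_fun h1 j
    simp [this]
  · have h3 := DFunLike.congr_fun h1 j
    simp [Ne.symm h2] at h3
  · subst h2
    have : e ≠ 1 := fun h => h1 (by rw [h])
    simp [PowerSeries.coeff_X, this]
  · simp

theorem toAxis_C [Field k] (t : Fin n) (a : k) :
    toAxis t (MvPowerSeries.C a : MvPowerSeries (Fin n) k) = PowerSeries.C a := by
  classical
  ext e
  rw [toAxis, RingHom.coe_mk, MonoidHom.coe_mk, OneHom.coe_mk, PowerSeries.coeff_mk,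
    MvPowerSeries.coeff_C, PowerSeries.coeff_C]
  simp

/-- The restriction of `p(x_j + c_j x_t)` to the `x_t`-axis is the restriction of `p` to the line
through `v`, where `v_j = c_j` for `j ≠ t` and `v_t = 1`. Hence a line on which the initial form of
`p` does not vanish provides `c`. -/
theorem exists_coeff_shear_ne_zero [Field k] [Infinite k] (t : Fin n)
    {p : MvPowerSeries (Fin n) k} (hp : p ≠ 0) : ∃ (c : Fin n → k) (e : ℕ), c t = 0 ∧
      MvPowerSeries.coeff (Finsupp.single t e) (shear t c p) ≠ 0 := by
  classical
  obtain ⟨d₀, hd₀⟩ : ∃ d, MvPowerSeries.coeff d p ≠ 0 := by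
    by_contra! h
    exact hp (MvPowerSeries.ext h)
  set e := d₀.degree with he
  -- the homogeneous part of degree `e`
  have hfin : {d : Fin n →₀ ℕ | d.degree = e}.Finite :=
    (Finsupp.finite_of_degree_le e).subset fun d hd => le_of_eq hd
  let S := hfin.toFinset
  have hS (d) : d ∈ S ↔ d.degree = e := hfin.mem_toFinset
  let P : MvPolynomial (Fin n) k := ∑ d ∈ S, MvPolynomial.monomial d (MvPowerSeries.coeff d p)
  have hP : P ≠ 0 := by
    intro h0
    have h1 := congrArg (MvPolynomial.coeff d₀) h0
    simp only [P, MvPolynomial.coeff_sum, MvPolynomial.coeff_monomial, Finset.sum_ite_eq',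
      if_pos ((hS d₀).2 rfl), MvPolynomial.coeff_zero] at h1
    exact hd₀ h1
  obtain ⟨v, hv⟩ : ∃ v, MvPolynomial.eval v (P * MvPolynomial.X t) ≠ 0 := by
    by_contra! h
    exact mul_ne_zero hP (MvPolynomial.X_ne_zero t) (MvPolynomial.funext fun v => by simp [h v])
  rw [map_mul, MvPolynomial.eval_X] at hv
  have hvt := right_ne_zero_of_mul hv
  have hPv : ∑ d ∈ S, MvPowerSeries.coeff d p * ∏ j, v j ^ d j ≠ 0 := by
    have := left_ne_zero_of_mul hv
    simpa only [P, map_sum, MvPolynomial.eval_monomial,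
      Finsupp.prod_fintype _ _ fun j => pow_zero _] using this
  let c : Fin n → k := fun j => if j = t then 0 else v j / v t
  refine ⟨c, e, by simp [c], ?_⟩
  have hcoeff (d : Fin n →₀ ℕ) : MvPowerSeries.coeff (Finsupp.single t e) (∏ j,
      (MvPowerSeries.X j + MvPowerSeries.C (c j) * MvPowerSeries.X t :
        MvPowerSeries (Fin n) k) ^ d j) = if d.degree = e then ∏ j, (v j / v t) ^ d j else 0 := by
    have h1 : toAxis t (∏ j, (MvPowerSeries.X j + MvPowerSeries.C (c j) * MvPowerSeries.X t :
        MvPowerSeries (Fin n) k) ^ d j) =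
        PowerSeries.C (∏ j, (v j / v t) ^ d j) * PowerSeries.X ^ d.degree := by
      rw [map_prod, map_prod, Finsupp.degree_eq_sum, ← Finset.prod_pow_eq_pow_sum,
        ← Finset.prod_mul_distrib]
      refine Finset.prod_congr rfl fun j _ => ?_
      rw [map_pow, map_pow, ← mul_pow, map_add, map_mul, toAxis_X, toAxis_X, toAxis_C]
      congr 1
      by_cases hj : j = t
      · simp [c, hj, hvt]
      · simp [c, hj]
    have h2 := congrArg (PowerSeries.coeff e) h1
    rw [PowerSeries.coeff_C_mul, PowerSeries.coeff_X_pow, toAxis, RingHom.coe_mk, MonoidHom.coe_mk,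
      OneHom.coe_mk, PowerSeries.coeff_mk] at h2
    rw [h2]
    by_cases h : d.degree = e
    · simp [h]
    · simp [h, Ne.symm h]
  rw [coeff_shear, finsum_eq_sum_of_support_subset (s := S)]
  · have h3 : ∑ d ∈ S, MvPowerSeries.coeff d p * MvPowerSeries.coeff (Finsupp.single t e) (∏ j,
        (MvPowerSeries.X j + MvPowerSeries.C (c j) * MvPowerSeries.X t :
          MvPowerSeries (Fin n) k) ^ d j) =
        (∑ d ∈ S, MvPowerSeries.coeff d p * ∏ j, v j ^ d j) / v t ^ e := by
      rw [Finset.sum_div]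
      refine Finset.sum_congr rfl fun d hd => ?_
      have hde := (hS d).1 hd
      rw [hcoeff, if_pos hde, Finset.prod_congr rfl fun j _ => div_pow _ _ _,
        Finset.prod_div_distrib, Finset.prod_pow_eq_pow_sum, ← Finsupp.degree_eq_sum, hde,
        mul_div_assoc]
    rw [h3]
    exact div_ne_zero hPv (pow_ne_zero _ hvt)
  · intro d hd
    rw [Function.mem_support, hcoeff] at hd
    by_contra h
    exact hd (by rw [if_neg fun h' => h ((hS d).2 h'), mul_zero])

end Shear

/-! ### Finiteness of normalizations for convergent power series -/

section

variable {k : Type u} [NormedField k] [CharZero k] {n : ℕ}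

/-- Induction on the number of variables: a quotient domain with non-zero kernel is, after a linear
change of coordinates and by Weierstrass division, finite over a quotient domain of the ring of
power series in one variable less. -/
theorem hasFiniteNormalizations_convergentIn (T : Finset (Fin n)) :
    HasFiniteNormalizations.{w} (convergentIn k T) := by
  induction T using Finset.strongInduction with
  | H T ih =>
  intro D K _ _ _ _ _ π hπ
  by_cases hker : ∀ f, π f = 0 → f = 0
  · have hinj : Function.Injective π := (injective_iff_map_eq_zero π).2 hker
    have : IsIntegrallyClosed D :=
      IsIntegrallyClosed.of_equiv (RingEquiv.ofBijective π ⟨hinj, hπ⟩)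
    exact finite_integralClosure_of_isIntegrallyClosed D K
  push Not at hker
  obtain ⟨f, hf, hf0⟩ := hker
  have hf0' : (f : MvPowerSeries (Fin n) k) ≠ 0 := fun h => hf0 (Subtype.ext h)
  obtain ⟨t, ht⟩ : T.Nonempty := by
    -- without variables there are only constants
    rw [Finset.nonempty_iff_ne_empty]
    rintro rfl
    have hconst : (f : MvPowerSeries (Fin n) k) =
        algebraMap k _ (MvPowerSeries.coeff 0 (f : MvPowerSeries (Fin n) k)) := by
      classical
      ext m
      rw [MvPowerSeries.algebraMap_apply, Algebra.algebraMap_self_apply, MvPowerSeries.coeff_C]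
      split_ifs with hm
      · rw [hm]
      · by_contra h
        exact hm (Finsupp.support_eq_empty.1 (Finset.subset_empty.1 (f.2.2 m h)))
    have hf1 : f = algebraMap k (convergentIn k ∅) (MvPowerSeries.coeff 0 f.1) := Subtype.ext hconst
    rw [hf1] at hf hf0
    exact hf0 (by rw [(map_eq_zero (π.comp (algebraMap k (convergentIn k ∅)))).1 hf, map_zero])
  obtain ⟨c, e, hc, hce⟩ := exists_coeff_shear_ne_zero t hf0'
  -- after the change of coordinates `f` is regular in `x_t`
  let σ (c : Fin n → k) : convergentIn k T →+* convergentIn k T :=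
    ((shear t c).domRestrict (convergentIn k T)).toRingHom.codRestrict _
      fun p => shear_mem_convergentIn ht c p.2
  have hσ (p) : σ (-c) (σ c p) = p := Subtype.ext (shear_neg_shear hc p)
  have hσ' (p) : σ c (σ (-c) p) = p := Subtype.ext (shear_shear_neg hc p)
  let φ := π.comp (σ (-c))
  have hφ : Function.Surjective φ := hπ.comp fun p => ⟨σ c p, hσ p⟩
  have hφf : φ (σ c f) = 0 := by rw [RingHom.comp_apply, hσ, hf]
  obtain ⟨d, hd⟩ := exists_weierstrass_division (σ c f) hce
  let i : convergentIn k (T.erase t) →+* convergentIn k T :=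
    (Subalgebra.inclusion (convergentIn_mono (T.erase_subset t))).toRingHom
  let g := φ.comp i
  have hN := ih (T.erase t) (Finset.erase_ssubset ht) g.range (FractionRing g.range)
    g.rangeRestrict g.rangeRestrict_surjective
  have : IsNoetherianRing g.range := isNoetherianRing_range g
  have : CharZero g.range :=
    charZero_of_injective_ringHom (f := g.rangeRestrict.comp (algebraMap k _)) (RingHom.injective _)
  let x : D := φ ⟨MvPowerSeries.X t, X_mem_convergentIn ht⟩
  -- by Weierstrass division the powers of `x_t` below the `d`-th generate `D`
  have : Module.Finite g.range D := by
    classical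
    refine ⟨⟨(Finset.range d).image (x ^ ·), eq_top_iff.2 fun y _ => ?_⟩⟩
    obtain ⟨p, rfl⟩ := hφ y
    obtain ⟨q, r, hpr, hr⟩ := hd p
    have hrsum : r = ∑ e ∈ Finset.range d, i ⟨_, variableCoeff_mem r.2 t e⟩ *
        ⟨MvPowerSeries.X t, X_mem_convergentIn ht⟩ ^ e := by
      apply Subtype.ext
      push_cast
      exact eq_sum_variableCoeff hr
    rw [hpr, map_add, map_mul, hφf, mul_zero, zero_add, hrsum, map_sum]
    refine sum_mem fun e he => ?_
    rw [map_mul, map_pow]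
    exact Submodule.smul_mem _ (⟨_, _, rfl⟩ : g.range)
      (Submodule.subset_span (Finset.mem_coe.2 (Finset.mem_image_of_mem _ he)))
  have hfin := finite_integralClosure_of_finite (D := D) (K := K) hN
  exact Module.Finite.of_restrictScalars_finite g.range D _

end

/-! ### The three rings of germs -/

section Germs

theorem isNoetherianRing_convergentPowerSeries (k : Type u) [NormedField k] (n : ℕ) :
    IsNoetherianRing (convergentPowerSeries k n) := by
  refine isNoetherianRing_of_surjective (convergentIn k Finset.univ) _
    (Subalgebra.inclusion inf_le_left).toRingHom fun p => ?_
  exact ⟨⟨p, p.2, fun m _ => m.support.subset_univ⟩, rfl⟩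

theorem hasFiniteNormalizations_convergentPowerSeries (k : Type u) [NormedField k] [CharZero k]
    (n : ℕ) : HasFiniteNormalizations.{w} (convergentPowerSeries k n) := by
  refine (hasFiniteNormalizations_convergentIn (Finset.univ : Finset (Fin n))).of_surjective
    (Subalgebra.inclusion inf_le_left).toRingHom fun p => ?_
  exact ⟨⟨p, p.2, fun m _ => m.support.subset_univ⟩, rfl⟩

/-- For a norm bounded by one every formal power series converges: for distinct prime weights `wᵢ`
its norm on the polydisc of radius `wᵢ ^ (-2)` is at most `∑ j ^ (-2)`. -/
theorem isConvergent_of_norm_le_one {k : Type u} [NormedField k] (h : ∀ a : k, ‖a‖ ≤ 1) {n : ℕ}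
    (p : MvPowerSeries (Fin n) k) : IsConvergent p := by
  obtain ⟨w, hw, hinj⟩ := exists_prime_weights n
  refine isConvergent_of_polyNorm_weightRadius (w := w) (s := 2) (ne_top_of_le_ne_top
    (Real.summable_one_div_nat_pow.2 one_lt_two).tsum_ofReal_ne_top (le_trans ?_
      (ENNReal.tsum_comp_le_tsum_of_injective (monomialValue_injective hw hinj) _)))
  refine ENNReal.tsum_le_tsum fun m => ?_
  have hpos : 0 < monomialValue w m := Finset.prod_pos fun i _ => pow_pos (hw i).pos _
  have h1 : ‖MvPowerSeries.coeff m p‖ₑ ≤ 1 := by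
    rw [← ofReal_norm]
    exact ENNReal.ofReal_le_one.2 (h _)
  rw [monomialValue_weightRadius, one_div, ENNReal.ofReal_inv_of_pos (by positivity),
    ENNReal.ofReal_pow (by positivity), ENNReal.ofReal_natCast, ENNReal.inv_pow]
  exact mul_le_of_le_one_left zero_le h1

/-- Formal power series are the convergent power series for the trivial norm. -/
theorem hasFiniteNormalizations_mvPowerSeries (k : Type u) [Field k] [CharZero k] (n : ℕ) :
    HasFiniteNormalizations.{w} (MvPowerSeries (Fin n) k) := by
  have h (k : Type u) [NormedField k] [CharZero k] (h : ∀ a : k, ‖a‖ ≤ 1) :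
      HasFiniteNormalizations.{w} (MvPowerSeries (Fin n) k) :=
    (hasFiniteNormalizations_convergentPowerSeries k n).of_surjective
      (convergentPowerSeries k n).val.toRingHom
      fun p => ⟨⟨p, isConvergent_of_norm_le_one h p⟩, rfl⟩
  classical
  let v : AbsoluteValue k ℝ := AbsoluteValue.trivial
  refine @h k v.toNormedField _ fun a => ?_
  change v a ≤ 1
  rcases eq_or_ne a 0 with rfl | ha
  · simp
  · exact (AbsoluteValue.trivial_apply ha).le

variable {k : Type u} [NormedField k] {n : ℕ} {O : Type v} [CommRing O] [Algebra k O]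

theorem IsFunctionGermRing.isDomain (hO : IsFunctionGermRing k n O) : IsDomain O := by
  rcases hO with ⟨⟨e⟩⟩ | ⟨⟨e⟩⟩ | ⟨⟨e⟩⟩
  · exact e.toMulEquiv.isDomain
  · have : IsDomain (MvPowerSeries (Fin n) k) := NoZeroDivisors.to_isDomain _
    have : IsDomain (convergentPowerSeries k n) := inferInstance
    exact e.toMulEquiv.isDomain
  · have : IsDomain (MvPowerSeries (Fin n) k) := NoZeroDivisors.to_isDomain _
    exact e.toMulEquiv.isDomain

theorem IsFunctionGermRing.isNoetherianRing (hO : IsFunctionGermRing k n O) :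
    IsNoetherianRing O := by
  rcases hO with ⟨⟨e⟩⟩ | ⟨⟨e⟩⟩ | ⟨⟨e⟩⟩
  · exact isNoetherianRing_of_ringEquiv _ e.symm.toRingEquiv
  · have := isNoetherianRing_convergentPowerSeries k n
    exact isNoetherianRing_of_ringEquiv _ e.symm.toRingEquiv
  · exact isNoetherianRing_of_ringEquiv _ e.symm.toRingEquiv

theorem IsFunctionGermRing.hasFiniteNormalizations [CharZero k] (hO : IsFunctionGermRing k n O) :
    HasFiniteNormalizations.{w} O := by
  rcases hO with ⟨⟨e⟩⟩ | ⟨⟨e⟩⟩ | ⟨⟨e⟩⟩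
  · exact (hasFiniteNormalizations_localization n (originIdeal k n)).of_surjective
      e.symm.toRingEquiv.toRingHom e.symm.surjective
  · exact (hasFiniteNormalizations_convergentPowerSeries k n).of_surjective
      e.symm.toRingEquiv.toRingHom e.symm.surjective
  · exact (hasFiniteNormalizations_mvPowerSeries k n).of_surjective
      e.symm.toRingEquiv.toRingHom e.symm.surjective

end Germs

/-! ### Saturated modules on hypersurface germs -/

theorem mainTheorem9 {k : Type u} [NormedField k] [CompleteSpace k] [IsAlgClosed k] [CharZero k]
    (n : ℕ) {O : Type v} [CommRing O] [Algebra k O] (hO : IsFunctionGermRing k n O)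
    (f : O) (hf0 : f ≠ 0) (hf : ¬ IsUnit f) :
    -- (0) every torsion-free module on `X = {f = 0}` is `X/X`-saturated
    (∀ (E : Type w) [AddCommGroup E] [Module (HypersurfaceRing f) E],
      Module.IsTorsionFree (HypersurfaceRing f) E →
        IsSaturated (HypersurfaceRing f) (HypersurfaceRing f) E) ∧
    -- (1) the unique maximal finite modification for which `E` is saturated
    (∀ (E : Type w) [AddCommGroup E] [Module (HypersurfaceRing f) E],
      Module.IsTorsionFree (HypersurfaceRing f) E →
      (IsReduced (HypersurfaceRing f) ∨
        (Module.Finite (HypersurfaceRing f) E ∧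
          ∀ a : HypersurfaceRing f, IsNilpotent a → (∀ e : E, a • e = 0) → a = 0)) →
      ∃ (B : Type v) (_ : CommRing B) (_ : Algebra (HypersurfaceRing f) B),
        IsMaximalSaturatingModification (HypersurfaceRing f) B E ∧
        ∀ (B' : Type v) [CommRing B'] [Algebra (HypersurfaceRing f) B'],
          IsMaximalSaturatingModification (HypersurfaceRing f) B' E →
            Nonempty (B' ≃ₐ[HypersurfaceRing f] B)) ∧
    -- (2) and (3), for the kernel `E` of a determinantal representation `M` of `X` and for
    -- `tr(E)`, the kernel of the transposed matrix
    (∀ (d : ℕ), 1 < d → ∀ (M : Matrix (Fin d) (Fin d) O), (∀ i j, ¬ IsUnit (M i j)) →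
      M.det = f →
      ∀ (B : Type v) [CommRing B] [Algebra (HypersurfaceRing f) B],
        IsFiniteModification (HypersurfaceRing f) B →
        (IsSaturated (HypersurfaceRing f) B (kernelModule f M) ↔ IsSaturatedDetRep f B M) ∧
        (IsSaturated (HypersurfaceRing f) B (kernelModule f M) ↔
          IsSaturated (HypersurfaceRing f) B (kernelModule f M.transpose))) := by
  have := hO.isDomain
  have := hO.isNoetherianRing
  have hN : HasFiniteNormalizations.{v} (HypersurfaceRing f) :=
    hO.hasFiniteNormalizations.of_surjective _ Ideal.Quotient.mk_surjective
  refine ⟨fun E _ _ hE => isSaturated_self, fun E _ _ hE hEN => ?_,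
    fun d _ M _ hM B _ _ hB => ?_⟩
  · have hmax := exists_isMaximalSaturatingModification E hN hEN
    exact ⟨_, _, _, hmax, fun B' _ _ hB' => hmax.nonempty_algEquiv hB'⟩
  · have hsat := isSaturated_kernelModule_iff hf0 hM hB
    have hsatT := isSaturated_kernelModule_iff hf0 (M.det_transpose.trans hM) hB
    exact ⟨hsat, by rw [hsat, hsatT, isSaturatedDetRep_transpose]⟩
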